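/- Let $X$ be a complex Banach space and let $S$ be a densely defined linear operator in $X$ with domain $\mathcal D(S)$. Let $\varrho(S)$ be its resolvent set, i.e. the set of $\lambda\in\mathbb C$ for which $S-\lambda:\mathcal D(S)\to X$ is bijective with bounded inverse. Suppose that for some $h>0$ $$\{\lambda\in\mathbb C:|\operatorname{Re}\lambda|\le h\}\subset\varrho(S)\qquad\text{and}\qquad \sup_{|\operatorname{Re}\lambda|\le h}\|(S-\lambda)^{-1}\|<\infty .$$ Define bounded operators on $X$ by $$A_\pm=\frac{\pm1}{2\pi i}\int_{\pm h-i\infty}^{\pm h+i\infty}\frac1{\lambda^2}(S-\lambda)^{-1}\,d\lambda ,$$ and put $M_\pm=\overline{\operatorname{range}(A_\pm)}$ and $P_\pm=S^2A_\pm$ with $\mathcal D(P_\pm)=\{x\in X:A_\pm x\in\mathcal D(S^2)\}$. Let $G_+$ (respectively $G_-$) be the subspace of all $x\in X$ for which $\lambda\mapsto(S-\lambda)^{-1}x$, $\lambda\in\varrho(S)$, has an extension that is analytic on a neighbourhood of $H\cup\varrho(S)$ and bounded on $H$, where $H=\{\operatorname{Re}\lambda\le0\}$ (respectively $H=\{\operatorname{Re}\lambda\ge0\}$).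 Let $S|G_\pm$ be the restriction of $S$ to $\mathcal D(S)\cap G_\pm$; it is called densely defined if $\mathcal D(S)\cap G_\pm$ is dense in $G_\pm$. Let $S_{M\pm}$ be the part of $S$ in $M_\pm$, i.e. the restriction of $S$ to $\{x\in\mathcal D(S)\cap M_\pm: Sx\in M_\pm\}$. A subspace $Z$ is called $S$-invariant if $S(\mathcal D(S)\cap Z)\subset Z$. Then, with the upper signs throughout or the lower signs throughout in (i): (i) $S|G_\pm$ is densely defined $\iff M_\pm=G_\pm\iff M_\pm$ is $S$-invariant. In particular, $S_{M\pm}=S|G_\pm$ if $M_\pm=G_\pm$. (ii) $P_+$ is bounded (on its domain) if and only if $P_-$ is bounded, and in this case $M_+=G_+$ and $M_-=G_-$. (iii) Suppose there are bounded operators $Q_n$ on $X$, $n\in\mathbb N$, with $\operatorname{range}(Q_n)\subset\mathcal D(S)$, $Q_n(S-\lambda)^{-1}=(S-\lambda)^{-1}Q_n$ for all $\lambda\in\varrho(S)$, and $Q_nx\to x$ for all $x\in X$. Then $M_+=G_+$ and $M_-=G_-$. -/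

import Mathlib

open Filter Topology MeasureTheory

noncomputable section

namespace Splitting

variable {X : Type*} [NormedAddCommGroup X] [NormedSpace ℂ X]

/-- `R` is the everywhere defined bounded inverse of `S - z : D(S) → X`. -/
def IsResolventAt (S : X →ₗ.[ℂ] X) (z : ℂ) (R : X →L[ℂ] X) : Prop :=
  (∀ x : S.domain, R (S x - z • (x : X)) = x) ∧
    ∀ y : X, ∃ x : S.domain, (x : X) = R y ∧ S x - z • (x : X) = y

/-- The resolvent set of `S`: those `z` for which `S - z : D(S) → X` is bijective with
bounded inverse. -/
def resolventSetOf (S : X →ₗ.[ℂ] X) : Set ℂ :=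
  {z | ∃ R : X →L[ℂ] X, IsResolventAt S z R}

open Classical in
/-- The resolvent `(S - z)⁻¹` for `z` in the resolvent set (and `0` for other `z`). -/
def resolventOf (S : X →ₗ.[ℂ] X) (z : ℂ) : X →L[ℂ] X :=
  if hz : ∃ R : X →L[ℂ] X, IsResolventAt S z R then hz.choose else 0

/-- The closed strip `|Re z| ≤ h` lies in the resolvent set and the resolvent is uniformly
bounded there. -/
def StripBound (S : X →ₗ.[ℂ] X) (h : ℝ) : Prop :=
  (∀ z : ℂ, |z.re| ≤ h → z ∈ resolventSetOf S) ∧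
    ∃ M : ℝ, ∀ z : ℂ, |z.re| ≤ h → ‖resolventOf S z‖ ≤ M

/-- The subspace of all `x` for which `z ↦ (S - z)⁻¹ x`, defined on the resolvent set, has an
extension `φ` that is analytic on (a neighbourhood of) `H ∪ ρ(S)` and bounded on `H`. -/
def boundedExtensionSpace (S : X →ₗ.[ℂ] X) (H : Set ℂ) : Submodule ℂ X where
  carrier := {x | ∃ φ : ℂ → X, AnalyticOnNhd ℂ φ (H ∪ resolventSetOf S) ∧
    (∀ z ∈ resolventSetOf S, φ z = resolventOf S z x) ∧
    ∃ C : ℝ, ∀ z ∈ H, ‖φ z‖ ≤ C}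
  zero_mem' := ⟨fun _ => 0, analyticOnNhd_const, by simp, 0, by simp⟩
  add_mem' := by
    rintro x y ⟨φ, hφ, hφ', C, hC⟩ ⟨ψ, hψ, hψ', D, hD⟩
    refine ⟨fun z => φ z + ψ z, hφ.add hψ, fun z hz => ?_, C + D, fun z hz => ?_⟩
    · simp only [hφ' z hz, hψ' z hz, map_add]
    · exact (norm_add_le _ _).trans (add_le_add (hC z hz) (hD z hz))
  smul_mem' := by
    rintro c x ⟨φ, hφ, hφ', C, hC⟩
    refine ⟨fun z => c • φ z, analyticOnNhd_const.smul hφ, fun z hz => ?_, ‖c‖ * C,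
      fun z hz => ?_⟩
    · simp only [hφ' z hz, map_smul]
    · rw [norm_smul]
      exact mul_le_mul_of_nonneg_left (hC z hz) (norm_nonneg c)

/-- `G₊`: bounded analytic extension to the closed left half-plane. -/
def GPlus (S : X →ₗ.[ℂ] X) : Submodule ℂ X := boundedExtensionSpace S {z | z.re ≤ 0}

/-- `G₋`: bounded analytic extension to the closed right half-plane. -/
def GMinus (S : X →ₗ.[ℂ] X) : Submodule ℂ X := boundedExtensionSpace S {z | 0 ≤ z.re}

/-- `∫ z⁻² (S - z)⁻¹ dz` along the upward vertical line `Re z = c`, parametrised as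
`z = c + i t`, `dz = i dt`; a Bochner integral in the operator norm. -/
def lineIntegral (S : X →ₗ.[ℂ] X) (c : ℝ) : X →L[ℂ] X :=
  ∫ t : ℝ, (Complex.I * (1 / ((c : ℂ) + t * Complex.I) ^ 2)) •
    resolventOf S ((c : ℂ) + t * Complex.I)

/-- The operator `A₊`. -/
def APlus (S : X →ₗ.[ℂ] X) (h : ℝ) : X →L[ℂ] X :=
  (1 / (2 * (Real.pi : ℂ) * Complex.I)) • lineIntegral S h

/-- The operator `A₋`. -/
def AMinus (S : X →ₗ.[ℂ] X) (h : ℝ) : X →L[ℂ] X :=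
  (-1 / (2 * (Real.pi : ℂ) * Complex.I)) • lineIntegral S (-h)

/-- `M₊`, the closure of the range of `A₊`. -/
def MPlus (S : X →ₗ.[ℂ] X) (h : ℝ) : Submodule ℂ X :=
  (LinearMap.range (APlus S h : X →ₗ[ℂ] X)).topologicalClosure

/-- `M₋`, the closure of the range of `A₋`. -/
def MMinus (S : X →ₗ.[ℂ] X) (h : ℝ) : Submodule ℂ X :=
  (LinearMap.range (AMinus S h : X →ₗ[ℂ] X)).topologicalClosure

/-- The composition `T ∘ U` on its natural domain `{x ∈ D(U) | U x ∈ D(T)}`. -/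
def compOp (T U : X →ₗ.[ℂ] X) : X →ₗ.[ℂ] X where
  domain := (T.domain.comap U.toFun).map U.domain.subtype
  toFun :=
    { toFun := fun x =>
        T ⟨U ⟨x, (Submodule.mem_map.1 x.2).elim fun y hy => hy.2 ▸ y.2⟩, by
          obtain ⟨x, hx⟩ := x
          obtain ⟨y, hy, rfl⟩ := Submodule.mem_map.1 hx
          exact hy⟩
      map_add' := fun x y => by
        rw [← LinearPMap.map_add]
        congr 1
        exact Subtype.ext (U.map_add ⟨x, _⟩ ⟨y, _⟩)
      map_smul' := fun c x => by
        rw [RingHom.id_apply, ← LinearPMap.map_smul]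
        congr 1
        exact Subtype.ext (U.map_smul c ⟨x, _⟩) }

/-- `S² A` on the natural domain `{x | A x ∈ D(S²)}`. -/
def sqComp (S : X →ₗ.[ℂ] X) (A : X →L[ℂ] X) : X →ₗ.[ℂ] X :=
  compOp (compOp S S) ((A : X →ₗ[ℂ] X).toPMap ⊤)

/-- The (possibly unbounded) projection `P₊ = S² A₊`. -/
def PPlus (S : X →ₗ.[ℂ] X) (h : ℝ) : X →ₗ.[ℂ] X := sqComp S (APlus S h)

/-- The (possibly unbounded) projection `P₋ = S² A₋`. -/
def PMinus (S : X →ₗ.[ℂ] X) (h : ℝ) : X →ₗ.[ℂ] X := sqComp S (AMinus S h)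

/-- Boundedness of an operator on its domain. -/
def IsBoundedOp (T : X →ₗ.[ℂ] X) : Prop :=
  ∃ C : ℝ, ∀ x : T.domain, ‖T x‖ ≤ C * ‖(x : X)‖

/-- `Z` is `S`-invariant: `S (D(S) ∩ Z) ⊆ Z`. -/
def IsInvariant (S : X →ₗ.[ℂ] X) (Z : Submodule ℂ X) : Prop :=
  ∀ x : S.domain, (x : X) ∈ Z → S x ∈ Z

/-- The operator `T`, whose domain is contained in `Z`, is densely defined in `Z`. -/
def IsDenselyDefinedIn (T : X →ₗ.[ℂ] X) (Z : Submodule ℂ X) : Prop :=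
  T.domain ≤ Z ∧ Dense {x : Z | (x : X) ∈ T.domain}

/-- The part of `S` in `Z`: the restriction of `S` to `{x ∈ D(S) ∩ Z | S x ∈ Z}`. -/
def partIn (S : X →ₗ.[ℂ] X) (Z : Submodule ℂ X) : X →ₗ.[ℂ] X :=
  S.domRestrict (Z ⊓ (Z.comap S.toFun).map S.domain.subtype)

end Splitting

end

/-! Write `R(z) = (S - z)⁻¹`. The function `z⁻² R(z)` has its only singularity in the strip at `0`,
with residue `S⁻²`, so shifting the contour gives `A₊ + A₋ = S⁻²` (`APlus_add_AMinus`).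

The analytic core is `G₊ = ker A₋` (`mem_GPlus_iff`). If `x ∈ G₊`, the integrand of `A₋ x` continues
to the left with quadratic decay, so the integral vanishes. If `A₋ x = 0`, then `A₊ x = S⁻² x`. The
resolvent identity writes `R(w) A₊ x` as a Cauchy integral over `Re z = h`, which is holomorphic for
`Re w < h` and bounded for `Re w ≤ 0`. Hence `R(w) x = S⁻¹ x + w S⁻² x + w² R(w) S⁻² x` extends with
quadratic growth, and Phragmén–Lindelöf makes the extension bounded. The same Cauchy integral shows
that the range of `A₊` lies in `G₊`. Replacing `S` by `-S` settles the other sign.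

The rest is algebra, isolated in `IsSplitPair`: `A` and `B` commute with `S⁻¹`, `A + B = S⁻²`, and
`range A ⊆ G = ker B`. So `G` is closed and `S`-invariant, `A = S⁻²` on `G`, and every claim becomes
an approximation of elements of `G` by elements of `range A` or of `G ∩ D(S)`. -/

noncomputable section

namespace Splitting

/-! ### Integrals along vertical lines and Phragmén–Lindelöf. -/

section VerticalLines

/-- Turns decay in `‖z‖` into an integrable weight in `Im z`, uniformly away from the imaginary
axis. -/
theorem inv_normSq_le {a : ℝ} (ha : a ≠ 0) (z : ℂ) (hz : |a| ≤ |z.re|) :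
    (‖z‖ ^ 2)⁻¹ ≤ (min (a ^ 2) 1)⁻¹ * (1 + z.im ^ 2)⁻¹ := by
  have h2 : a ^ 2 ≤ z.re ^ 2 := sq_le_sq.2 hz
  have hm : 0 < min (a ^ 2) 1 := lt_min (by positivity) one_pos
  rw [← mul_inv]
  refine inv_anti₀ (by positivity) ?_
  rw [Complex.sq_norm, Complex.normSq_apply]
  nlinarith [min_le_left (a ^ 2) 1, min_le_right (a ^ 2) 1, sq_nonneg z.im]

theorem line_re (a t : ℝ) : ((a : ℂ) + t * Complex.I).re = a := by simp

theorem line_ne_zero {a : ℝ} (ha : a ≠ 0) (t : ℝ) : (a : ℂ) + t * Complex.I ≠ 0 := fun h =>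
  ha (by simpa using congrArg Complex.re h)

theorem continuous_line (a : ℝ) : Continuous fun t : ℝ => (a : ℂ) + t * Complex.I := by
  fun_prop

variable {E : Type*} [NormedAddCommGroup E]

theorem continuous_comp_line {f : ℂ → E} {s : Set ℂ} {a : ℝ} (hf : ContinuousOn f s)
    (hs : ∀ z : ℂ, z.re = a → z ∈ s) : Continuous fun t : ℝ => f ((a : ℂ) + t * Complex.I) :=
  hf.comp_continuous (continuous_line a) fun t => hs _ (line_re a t)

theorem integrable_line {f : ℂ → E} {a C : ℝ}
    (hf : Continuous fun t : ℝ => f ((a : ℂ) + t * Complex.I))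
    (hC : ∀ z : ℂ, z.re = a → ‖f z‖ ≤ C * (1 + z.im ^ 2)⁻¹) :
    Integrable fun t : ℝ => f ((a : ℂ) + t * Complex.I) := by
  refine (integrable_inv_one_add_sq.const_mul C).mono' hf.aestronglyMeasurable
    (ae_of_all _ fun t => ?_)
  simpa using hC (a + t * Complex.I) (by simp)

variable [NormedSpace ℂ E]

/-- Cauchy's theorem on a vertical strip: the line of integration may be moved. -/
theorem integral_line_eq {f : ℂ → E} {a b C : ℝ} (hab : a ≤ b)
    (hf : DifferentiableOn ℂ f {z | a ≤ z.re ∧ z.re ≤ b})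
    (hC : ∀ z : ℂ, a ≤ z.re → z.re ≤ b → ‖f z‖ ≤ C * (1 + z.im ^ 2)⁻¹) :
    ∫ t : ℝ, f ((a : ℂ) + t * Complex.I) = ∫ t : ℝ, f ((b : ℂ) + t * Complex.I) := by
  have ia := integrable_line (f := f) (a := a) (C := C)
    (continuous_comp_line hf.continuousOn fun z hz => ⟨hz.ge, hz.le.trans hab⟩)
    fun z hz => hC z hz.ge (hz.le.trans hab)
  have ib := integrable_line (f := f) (a := b) (C := C)
    (continuous_comp_line hf.continuousOn fun z hz => ⟨hab.trans hz.ge, hz.le⟩)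
    fun z hz => hC z (hab.trans hz.ge) hz.le
  have la := intervalIntegral_tendsto_integral ia tendsto_neg_atTop_atBot tendsto_id
  have lb := intervalIntegral_tendsto_integral ib tendsto_neg_atTop_atBot tendsto_id
  -- The horizontal sides of the rectangle at heights `±T` contribute `O(T⁻²)`.
  have hor : ∀ T : ℝ, ‖∫ x : ℝ in a..b, f (x + (T : ℂ) * Complex.I)‖
      ≤ C * (1 + T ^ 2)⁻¹ * |b - a| := fun T => by
    refine intervalIntegral.norm_integral_le_of_norm_le_const fun x hx => ?_
    rw [Set.uIoc_of_le hab] at hx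
    simpa using hC (x + T * Complex.I) (by simpa using hx.1.le) (by simpa using hx.2)
  have h0 : Tendsto (fun T : ℝ => C * (1 + T ^ 2)⁻¹ * |b - a|) atTop (𝓝 0) := by
    have : Tendsto (fun T : ℝ => (1 + T ^ 2)⁻¹) atTop (𝓝 0) :=
      (tendsto_atTop_add_const_left _ _ (tendsto_pow_atTop two_ne_zero)).inv_tendsto_atTop
    simpa using (this.const_mul C).mul_const |b - a|
  have hup : Tendsto (fun T : ℝ => ∫ x : ℝ in a..b, f (x + (T : ℂ) * Complex.I)) atTop (𝓝 0) :=
    squeeze_zero_norm hor h0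
  have hdn : Tendsto (fun T : ℝ => ∫ x : ℝ in a..b, f (x + ((-T : ℝ) : ℂ) * Complex.I))
      atTop (𝓝 0) :=
    squeeze_zero_norm (fun T => by simpa using hor (-T)) h0
  have rect : ∀ T : ℝ, (∫ x : ℝ in a..b, f (x + ((-T : ℝ) : ℂ) * Complex.I)) -
      (∫ x : ℝ in a..b, f (x + (T : ℂ) * Complex.I)) +
      Complex.I • (∫ y : ℝ in (-T)..T, f (b + y * Complex.I)) -
      Complex.I • (∫ y : ℝ in (-T)..T, f (a + y * Complex.I)) = 0 := fun T =>
    Complex.integral_boundary_rect_eq_zero_of_differentiableOn f ⟨a, -T⟩ ⟨b, T⟩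
      (hf.mono fun z hz => by
        have := hz.1
        simp only [Set.mem_preimage] at this
        rw [Set.uIcc_of_le hab] at this
        exact this)
  have lim := ((hdn.sub hup).add (lb.const_smul Complex.I)).sub (la.const_smul Complex.I)
  have := tendsto_nhds_unique (lim.congr fun T => rect T) tendsto_const_nhds
  rw [sub_zero, zero_add, ← smul_sub, smul_eq_zero, or_iff_right Complex.I_ne_zero,
    sub_eq_zero] at this
  exact this.symm

/-- A vertical line integral of a function which is holomorphic to the right of the line and
decays quadratically vanishes. -/
theorem integral_line_eq_zero_of_right {f : ℂ → E} {a C : ℝ} (ha : 0 < a)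
    (hf : DifferentiableOn ℂ f {z | a ≤ z.re})
    (hC : ∀ z : ℂ, a ≤ z.re → ‖f z‖ ≤ C * (‖z‖ ^ 2)⁻¹) :
    ∫ t : ℝ, f ((a : ℂ) + t * Complex.I) = 0 := by
  have hC0 : 0 ≤ C := by
    have := (norm_nonneg _).trans (hC a (by simp))
    exact nonneg_of_mul_nonneg_left this (by simp; positivity)
  have hC' : ∀ z : ℂ, a ≤ z.re → ‖f z‖ ≤ C * (min (a ^ 2) 1)⁻¹ * (1 + z.im ^ 2)⁻¹ :=
    fun z hz => (hC z hz).trans <| by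
      rw [mul_assoc]
      exact mul_le_mul_of_nonneg_left
        (inv_normSq_le ha.ne' z (by rwa [abs_of_pos ha, abs_of_nonneg (ha.le.trans hz)])) hC0
  have hconst : ∀ b : ℝ, a ≤ b → ∫ t : ℝ, f ((b : ℂ) + t * Complex.I) =
      ∫ t : ℝ, f ((a : ℂ) + t * Complex.I) := fun b hb =>
    (integral_line_eq hb (hf.mono fun z hz => hz.1) fun z hz _ => hC' z hz).symm
  -- The integral does not depend on the line; pushing the line to `Re z = +∞` makes it tend to `0`
  -- by dominated convergence.
  have lim : Tendsto (fun b : ℝ => ∫ t : ℝ, f ((b : ℂ) + t * Complex.I)) atTop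
      (𝓝 (∫ _ : ℝ, (0 : E))) := by
    refine tendsto_integral_filter_of_dominated_convergence
      (fun t => C * (min (a ^ 2) 1)⁻¹ * (1 + t ^ 2)⁻¹) ?_ ?_
      (integrable_inv_one_add_sq.const_mul _) (ae_of_all _ fun t => ?_)
    · filter_upwards [eventually_ge_atTop a] with b hb
      exact (continuous_comp_line hf.continuousOn fun z hz =>
        hb.trans hz.ge).aestronglyMeasurable
    · filter_upwards [eventually_ge_atTop a] with b hb
      refine ae_of_all _ fun t => ?_
      simpa using hC' (b + t * Complex.I) (by simpa using hb)
    · have h0 : Tendsto (fun b : ℝ => C * (b ^ 2)⁻¹) atTop (𝓝 0) := by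
        simpa using (tendsto_pow_atTop (α := ℝ) two_ne_zero).inv_tendsto_atTop.const_mul C
      refine squeeze_zero_norm' ?_ h0
      filter_upwards [eventually_ge_atTop a] with b hb
      refine (hC _ (by simpa using hb)).trans (mul_le_mul_of_nonneg_left ?_ hC0)
      have : 0 < b := ha.trans_le hb
      refine inv_anti₀ (by positivity) ?_
      rw [Complex.sq_norm, Complex.normSq_apply]
      simp
      nlinarith [sq_nonneg t]
  rw [integral_zero] at lim
  exact tendsto_nhds_unique (tendsto_const_nhds.congr' (by
    filter_upwards [eventually_ge_atTop a] with b hb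
    exact (hconst b hb).symm)) lim

/-- A vertical line integral of a function which is holomorphic to the left of the line and
decays quadratically vanishes. -/
theorem integral_line_eq_zero_of_left {f : ℂ → E} {a C : ℝ} (ha : a < 0)
    (hf : DifferentiableOn ℂ f {z | z.re ≤ a})
    (hC : ∀ z : ℂ, z.re ≤ a → ‖f z‖ ≤ C * (‖z‖ ^ 2)⁻¹) :
    ∫ t : ℝ, f ((a : ℂ) + t * Complex.I) = 0 := by
  have := integral_line_eq_zero_of_right (f := fun z => f (-z)) (a := -a) (C := C) (neg_pos.2 ha)
    (hf.comp differentiable_neg.differentiableOn fun z hz => by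
      have : -a ≤ z.re := hz
      show (-z).re ≤ a
      rw [Complex.neg_re]; linarith)
    (fun z hz => by
      simpa using hC (-z) (by rw [Complex.neg_re]; linarith))
  rw [← integral_neg_eq_self] at this
  rw [← this]
  congr 1 with t
  congr 1
  push_cast
  ring

theorem le_norm_line_sub {a r : ℝ} {w : ℂ} (hw : w.re ≤ a - r) (t : ℝ) :
    r ≤ ‖(a : ℂ) + t * Complex.I - w‖ := by
  refine le_trans ?_ (Complex.re_le_norm _)
  rw [Complex.sub_re, line_re]
  linarith

theorem line_sub_ne_zero {a : ℝ} {w : ℂ} (hw : w.re < a) (t : ℝ) :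
    (a : ℂ) + t * Complex.I - w ≠ 0 :=
  norm_pos_iff.1 ((sub_pos.2 hw).trans_le (le_norm_line_sub (by linarith) t))

theorem continuous_inv_line_sub {a : ℝ} {w : ℂ} (hw : w.re < a) :
    Continuous fun t : ℝ => ((a : ℂ) + t * Complex.I - w)⁻¹ :=
  ((continuous_line a).sub continuous_const).inv₀ (line_sub_ne_zero hw)

theorem integrable_inv_line_sub_smul {F : ℝ → E} (hF : Integrable F) {a : ℝ} {w : ℂ}
    (hw : w.re < a) : Integrable fun t : ℝ => ((a : ℂ) + t * Complex.I - w)⁻¹ • F t := by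
  refine (hF.norm.const_mul (a - w.re)⁻¹).mono'
    ((continuous_inv_line_sub hw).aestronglyMeasurable.smul hF.aestronglyMeasurable)
    (ae_of_all _ fun t => ?_)
  rw [norm_smul, norm_inv]
  exact mul_le_mul_of_nonneg_right (inv_anti₀ (sub_pos.2 hw) (le_norm_line_sub (by linarith) t))
    (norm_nonneg _)

/-- Holomorphic dependence of a Cauchy-type integral along a vertical line on the parameter. -/
theorem differentiableAt_cauchyIntegral {F : ℝ → E} (hF : Integrable F) {a : ℝ} {w : ℂ}
    (hw : w.re < a) :
    DifferentiableAt ℂ (fun w : ℂ => ∫ t : ℝ, ((a : ℂ) + t * Complex.I - w)⁻¹ • F t) w := by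
  -- Half the distance from `w` to the line: the kernel is bounded by `ε⁻¹` on a whole neighbourhood
  -- of `w`.
  set ε : ℝ := (a - w.re) / 2 with hε
  have hε0 : 0 < ε := by rw [hε]; linarith
  have hre : ∀ v ∈ {v : ℂ | v.re < w.re + ε}, v.re ≤ a - ε := fun v hv => by
    have h1 : v.re < w.re + ε := hv
    linarith
  have hlt : ∀ v ∈ {v : ℂ | v.re < w.re + ε}, v.re < a := fun v hv => by
    linarith [hre v hv]
  have hws : w ∈ {v : ℂ | v.re < w.re + ε} := by simpa using hε0
  have hopen : IsOpen {v : ℂ | v.re < w.re + ε} := isOpen_lt Complex.continuous_re continuous_const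
  have hinv : ∀ v ∈ {v : ℂ | v.re < w.re + ε}, ∀ t : ℝ,
      ‖((a : ℂ) + t * Complex.I - v)⁻¹‖ ≤ ε⁻¹ := fun v hv t => by
    rw [norm_inv]
    exact inv_anti₀ hε0 (le_norm_line_sub (hre v hv) t)
  refine (hasDerivAt_integral_of_dominated_loc_of_deriv_le (μ := volume)
    (F := fun (w : ℂ) (t : ℝ) => ((a : ℂ) + t * Complex.I - w)⁻¹ • F t)
    (F' := fun (w : ℂ) (t : ℝ) => (((a : ℂ) + t * Complex.I - w)⁻¹ ^ 2) • F t)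
    (bound := fun t => ε⁻¹ ^ 2 * ‖F t‖) (hopen.mem_nhds hws) ?_ ?_ ?_ ?_ ?_ ?_).2.differentiableAt
  · filter_upwards [hopen.mem_nhds hws] with v hv
    exact (continuous_inv_line_sub (hlt v hv)).aestronglyMeasurable.smul hF.aestronglyMeasurable
  · exact integrable_inv_line_sub_smul hF hw
  · exact ((continuous_inv_line_sub hw).pow 2).aestronglyMeasurable.smul hF.aestronglyMeasurable
  · refine ae_of_all _ fun t v hv => ?_
    rw [norm_smul, norm_pow]
    gcongr
    exact hinv v hv t
  · exact hF.norm.const_mul _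
  · refine ae_of_all _ fun t v hv => ?_
    have h1 : HasDerivAt (fun v : ℂ => (a : ℂ) + t * Complex.I - v) (-1) v := by
      simpa using (hasDerivAt_id v).const_sub ((a : ℂ) + t * Complex.I)
    have h2 := (h1.inv (line_sub_ne_zero (hlt v hv) t)).smul_const (F t)
    refine h2.congr_deriv ?_
    rw [inv_pow, neg_neg, one_div]

/-- Phragmén–Lindelöf in the left half-plane for functions of quadratic growth. -/
theorem norm_le_of_quadratic_growth_left {f : ℂ → E} {K C : ℝ}
    (hd : DifferentiableOn ℂ f {z | z.re ≤ 0})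
    (hK : ∀ z : ℂ, z.re ≤ 0 → ‖f z‖ ≤ K * (1 + ‖z‖) ^ 2)
    (hC : ∀ z : ℂ, z.re = 0 → ‖f z‖ ≤ C) {z : ℂ} (hz : z.re ≤ 0) : ‖f z‖ ≤ C := by
  have hK0 : 0 ≤ K := by
    have := (norm_nonneg _).trans (hK 0 (by simp))
    simpa using this
  have hC0 : 0 ≤ C := (norm_nonneg _).trans (hC 0 (by simp))
  -- The damping factor `(1 - εz)⁻²` has modulus at most `1` for `Re z ≤ 0` and absorbs the
  -- quadratic growth; `ε → 0` at the end.
  have key : ∀ ε : ℝ, 0 < ε → ε < 1 → ‖((1 - ε * z) ^ 2)⁻¹ • f z‖ ≤ C := by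
    intro ε hε hε1
    have hlow : ∀ w : ℂ, 0 ≤ w.re → 1 ≤ ‖1 + ε * w‖ := fun w hw => by
      refine le_trans ?_ (Complex.re_le_norm _)
      simp
      positivity
    have hlow2 : ∀ w : ℂ, 0 ≤ w.re → ε * ‖w‖ ≤ ‖1 + ε * w‖ := fun w hw => by
      have h1 : ε * ‖w‖ = ‖(ε : ℂ) * w‖ := by
        rw [norm_mul, Complex.norm_real, Real.norm_of_nonneg hε.le]
      rw [h1]
      refine abs_le_of_sq_le_sq' ?_ (norm_nonneg _) |>.2
      rw [Complex.sq_norm, Complex.sq_norm, Complex.normSq_apply, Complex.normSq_apply]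
      simp
      nlinarith [mul_nonneg hε.le hw]
    have hbd : ∀ w : ℂ, 0 ≤ w.re →
        ‖((1 + ε * w) ^ 2)⁻¹ • f (-w)‖ ≤ K * (1 + ε⁻¹) ^ 2 := fun w hw => by
      have hp : 0 < ‖1 + ε * w‖ := one_pos.trans_le (hlow w hw)
      rw [norm_smul, norm_inv, norm_pow, inv_mul_le_iff₀ (by positivity)]
      refine (hK (-w) (by simpa using hw)).trans ?_
      rw [norm_neg, mul_left_comm, ← mul_pow]
      refine mul_le_mul_of_nonneg_left (pow_le_pow_left₀ (by positivity) ?_ 2) hK0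
      rw [mul_add, mul_one]
      refine add_le_add (hlow w hw) ?_
      rw [le_mul_inv_iff₀ hε, mul_comm]
      exact hlow2 w hw
    have hdiff : DifferentiableOn ℂ (fun w : ℂ => ((1 + ε * w) ^ 2)⁻¹ • f (-w)) {w | 0 ≤ w.re} := by
      refine DifferentiableOn.smul (DifferentiableOn.inv (by fun_prop) fun w hw => ?_)
        (hd.comp differentiable_neg.differentiableOn fun w hw => by simpa using hw)
      have := hlow w hw
      exact pow_ne_zero _ (norm_pos_iff.1 (one_pos.trans_le this))
    have hPL := PhragmenLindelof.right_half_plane_of_bounded_on_real (C := C) (z := -z)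
      (f := fun w : ℂ => ((1 + ε * w) ^ 2)⁻¹ • f (-w)) ?_ ?_ ?_ ?_ (by simpa using hz)
    · simpa [sub_eq_add_neg] using hPL
    · refine DifferentiableOn.diffContOnCl (hdiff.mono ?_)
      rw [Complex.closure_setOfPred_lt_re]
    -- The damped function is bounded, so any exponent below `2` will do, with coefficient `0`.
    · refine ⟨1, by norm_num, 0, Asymptotics.IsBigO.of_bound (K * (1 + ε⁻¹) ^ 2) ?_⟩
      refine eventually_inf_principal.2 (Eventually.of_forall fun w hw => ?_)
      simpa using hbd w (le_of_lt hw)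
    · refine isBoundedUnder_of_eventually_le (a := K * (1 + ε⁻¹) ^ 2) ?_
      filter_upwards [eventually_ge_atTop 0] with x hx
      exact hbd x (by simpa using hx)
    · intro x
      have h1 := hlow (x * Complex.I) (by simp)
      rw [norm_smul, norm_inv, norm_pow, inv_mul_le_iff₀ (by positivity)]
      refine (hC _ (by simp)).trans ?_
      exact le_mul_of_one_le_left hC0 (one_le_pow₀ h1)
  have lim : Tendsto (fun ε : ℝ => ‖((1 - (ε : ℂ) * z) ^ 2)⁻¹ • f z‖) (𝓝[>] 0)
      (𝓝 ‖((1 - ((0 : ℝ) : ℂ) * z) ^ 2)⁻¹ • f z‖) := by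
    refine Tendsto.mono_left (ContinuousAt.tendsto ?_) nhdsWithin_le_nhds
    refine ((ContinuousAt.inv₀ (by fun_prop) (by simp)).smul continuousAt_const).norm
  have := le_of_tendsto lim (by
    filter_upwards [Ioo_mem_nhdsGT one_pos] with ε hε using key ε hε.1 hε.2)
  simpa using this

end VerticalLines

/-! ### The resolvent of an unbounded operator. -/

section Resolvent

variable {X : Type*} [NormedAddCommGroup X] [NormedSpace ℂ X] {S : X →ₗ.[ℂ] X}

theorem IsResolventAt.unique {z : ℂ} {R R' : X →L[ℂ] X} (hR : IsResolventAt S z R)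
    (hR' : IsResolventAt S z R') : R = R' := by
  ext y
  obtain ⟨x, hx, hy⟩ := hR.2 y
  rw [← hx, ← hy, hR'.1 x]

theorem isResolventAt_resolventOf {z : ℂ} (hz : z ∈ resolventSetOf S) :
    IsResolventAt S z (resolventOf S z) := by
  have hz' : ∃ R : X →L[ℂ] X, IsResolventAt S z R := hz
  rw [resolventOf, dif_pos hz']
  exact hz'.choose_spec

theorem IsResolventAt.resolventOf_eq {z : ℂ} {R : X →L[ℂ] X} (hR : IsResolventAt S z R) :
    resolventOf S z = R :=
  (isResolventAt_resolventOf ⟨R, hR⟩).unique hR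

theorem resolventOf_of_notMem {z : ℂ} (hz : z ∉ resolventSetOf S) : resolventOf S z = 0 :=
  dif_neg hz

/-- The first resolvent identity. -/
theorem resolventOf_sub {z w : ℂ} (hz : z ∈ resolventSetOf S) (hw : w ∈ resolventSetOf S) :
    resolventOf S z - resolventOf S w = (z - w) • (resolventOf S z ∘L resolventOf S w) := by
  ext y
  obtain ⟨x, hx, hy⟩ := (isResolventAt_resolventOf hw).2 y
  have h1 := (isResolventAt_resolventOf hz).1 x
  have h2 : S x - z • (x : X) = y - (z - w) • (x : X) := by
    rw [← hy, sub_smul]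
    abel
  rw [h2, map_sub, map_smul] at h1
  simp only [sub_apply, smul_apply,
    ContinuousLinearMap.comp_apply, ← hx]
  rw [sub_eq_iff_eq_add, add_comm]
  exact sub_eq_iff_eq_add.1 h1

theorem resolventOf_comm {z w : ℂ} (hz : z ∈ resolventSetOf S) (hw : w ∈ resolventSetOf S) :
    resolventOf S z ∘L resolventOf S w = resolventOf S w ∘L resolventOf S z := by
  rcases eq_or_ne z w with rfl | hne
  · rfl
  · have h1 := resolventOf_sub hz hw
    have h2 := resolventOf_sub hw hz
    have h3 : (z - w) • (resolventOf S z ∘L resolventOf S w) =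
        (z - w) • (resolventOf S w ∘L resolventOf S z) := by
      rw [← h1, ← neg_sub w z, neg_smul, ← h2, neg_sub]
    exact smul_right_injective _ (sub_ne_zero.2 hne) h3

/-- The resolvent identity at `(z, 0)`, iterated once. It exhibits the singularity of `z⁻² R(z)` at
`0` and expresses `R(z)` through `R(z) S⁻²`. -/
theorem resolventOf_eq_expansion (h0 : (0 : ℂ) ∈ resolventSetOf S) {z : ℂ}
    (hz : z ∈ resolventSetOf S) :
    resolventOf S z = resolventOf S 0 + z • (resolventOf S 0 ∘L resolventOf S 0) +
      z ^ 2 • (resolventOf S z ∘L (resolventOf S 0 ∘L resolventOf S 0)) := by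
  have h1 := resolventOf_sub hz h0
  rw [sub_zero, sub_eq_iff_eq_add] at h1
  have h2 : resolventOf S z ∘L resolventOf S 0 =
      z • (resolventOf S z ∘L (resolventOf S 0 ∘L resolventOf S 0)) +
        resolventOf S 0 ∘L resolventOf S 0 := by
    conv_lhs => rw [h1]
    ext y
    simp
  rw [pow_two, mul_smul, add_assoc, ← smul_add, add_comm (resolventOf S 0 ∘L _), ← h2, add_comm]
  exact h1

theorem resolventOf_zero_mem (h0 : (0 : ℂ) ∈ resolventSetOf S) (y : X) :
    resolventOf S 0 y ∈ S.domain := by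
  obtain ⟨x, hx, -⟩ := (isResolventAt_resolventOf h0).2 y
  exact hx ▸ x.2

theorem resolventOf_zero_apply (h0 : (0 : ℂ) ∈ resolventSetOf S) (x : S.domain) :
    resolventOf S 0 (S x) = x := by
  simpa using (isResolventAt_resolventOf h0).1 x

theorem apply_resolventOf_zero (h0 : (0 : ℂ) ∈ resolventSetOf S) {y : X} {x : S.domain}
    (hx : (x : X) = resolventOf S 0 y) : S x = y := by
  obtain ⟨x', hx', hy⟩ := (isResolventAt_resolventOf h0).2 y
  obtain rfl : x = x' := Subtype.ext (hx.trans hx'.symm)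
  simpa using hy

theorem resolventOf_zero_injective (h0 : (0 : ℂ) ∈ resolventSetOf S) :
    Function.Injective (resolventOf S 0) := fun y y' hyy' => by
  rw [← apply_resolventOf_zero h0 (x := ⟨_, resolventOf_zero_mem h0 y⟩) (y := y) rfl]
  exact apply_resolventOf_zero h0 hyy'

theorem eventually_norm_smul_lt (T : X →L[ℂ] X) (z : ℂ) :
    ∀ᶠ w in 𝓝 z, ‖(w - z) • T‖ < 1 := by
  have : Tendsto (fun w : ℂ => ‖(w - z) • T‖) (𝓝 z) (𝓝 ‖(z - z) • T‖) :=
    Continuous.tendsto (by fun_prop) z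
  rw [sub_self, zero_smul, norm_zero] at this
  exact this.eventually_lt_const one_pos

section Complete

variable [CompleteSpace X]

/-- On `D(S)`, `S - w = (1 - (w - z) R(z)) (S - z)`, and the first factor is inverted by a Neumann
series. -/
theorem isResolventAt_neumann {z w : ℂ} (hz : z ∈ resolventSetOf S)
    (hw : ‖(w - z) • resolventOf S z‖ < 1) :
    IsResolventAt S w
      (resolventOf S z * Ring.inverse (1 - (w - z) • resolventOf S z)) := by
  set T := resolventOf S z with hT
  have hRes := isResolventAt_resolventOf hz
  obtain ⟨u, hu⟩ := isUnit_one_sub_of_norm_lt_one hw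
  rw [← hu, Ring.inverse_unit]
  have hcomm : Commute T (u : X →L[ℂ] X) := by
    rw [hu]
    exact (Commute.one_right T).sub_right ((Commute.refl T).smul_right _)
  have hU : ∀ y, (u : X →L[ℂ] X) y = y - (w - z) • T y := fun y => by rw [hu]; simp
  constructor
  · intro x
    rw [hcomm.units_inv_right.eq]
    have h1 : T (S x - w • (x : X)) = (u : X →L[ℂ] X) x := by
      have : S x - w • (x : X) = (S x - z • (x : X)) - (w - z) • (x : X) := by
        rw [sub_smul]; abel
      rw [hU, this, map_sub, map_smul, hRes.1]
    have h2 : ((↑u⁻¹ : X →L[ℂ] X) * (u : X →L[ℂ] X)) (x : X) = x := by simp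
    rw [mul_apply_eq_comp, h1]
    exact h2
  · intro y
    obtain ⟨x, hx, hy⟩ := hRes.2 ((↑u⁻¹ : X →L[ℂ] X) y)
    refine ⟨x, hx, ?_⟩
    have h2 : ((u : X →L[ℂ] X) * (↑u⁻¹ : X →L[ℂ] X)) y = y := by simp
    rw [mul_apply_eq_comp, hU] at h2
    rw [← h2, ← hy]
    have h3 : T (S x - z • (x : X)) = x := hRes.1 x
    rw [h3, sub_smul]
    abel

theorem isOpen_resolventSetOf (S : X →ₗ.[ℂ] X) : IsOpen (resolventSetOf S) := by
  refine isOpen_iff_mem_nhds.2 fun z hz => ?_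
  filter_upwards [eventually_norm_smul_lt (resolventOf S z) z] with w hw
  exact ⟨_, isResolventAt_neumann hz hw⟩

theorem differentiableAt_resolventOf {z : ℂ} (hz : z ∈ resolventSetOf S) :
    DifferentiableAt ℂ (resolventOf S) z := by
  have h1 : (fun w => resolventOf S z * Ring.inverse (1 - (w - z) • resolventOf S z))
      =ᶠ[𝓝 z] resolventOf S := by
    filter_upwards [eventually_norm_smul_lt (resolventOf S z) z] with w hw
    exact (isResolventAt_neumann hz hw).resolventOf_eq.symm
  refine DifferentiableAt.congr_of_eventuallyEq ?_ h1.symm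
  refine DifferentiableAt.const_mul ?_ _
  have h2 : DifferentiableAt ℂ (Ring.inverse : (X →L[ℂ] X) → _)
      (1 - (z - z) • resolventOf S z) := by
    refine differentiableAt_inverse ?_
    simp
  exact h2.comp z (f := fun w : ℂ => 1 - (w - z) • resolventOf S z) (by fun_prop)

theorem differentiableOn_resolventOf_apply (S : X →ₗ.[ℂ] X) (x : X) :
    DifferentiableOn ℂ (fun z => resolventOf S z x) (resolventSetOf S) := fun _ hz =>
  ((differentiableAt_resolventOf hz).clm_apply (differentiableAt_const x)).differentiableWithinAt

end Complete

theorem StripBound.zero_mem {h : ℝ} (hst : StripBound S h) (hh : 0 < h) :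
    (0 : ℂ) ∈ resolventSetOf S :=
  hst.1 0 (by simpa using hh.le)

/-! ### Reflection `S ↦ -S` -/

theorem IsResolventAt.neg {z : ℂ} {R : X →L[ℂ] X} (hR : IsResolventAt S z R) :
    IsResolventAt (-S) (-z) (-R) := by
  have key : ∀ x : S.domain, (-S) x - (-z) • (x : X) = -(S x - z • (x : X)) := fun x => by
    rw [LinearPMap.neg_apply, neg_smul]; abel
  refine ⟨fun x => ?_, fun y => ?_⟩
  · have h1 := key x
    rw [h1, map_neg, neg_apply, neg_neg]
    exact hR.1 x
  · obtain ⟨x, hx, hy⟩ := hR.2 (-y)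
    refine ⟨x, ?_, ?_⟩
    · rw [hx, map_neg, neg_apply]
    · rw [key, hy, neg_neg]

theorem mem_resolventSetOf_neg {z : ℂ} : z ∈ resolventSetOf (-S) ↔ -z ∈ resolventSetOf S := by
  constructor
  · rintro ⟨R, hR⟩
    exact ⟨-R, by simpa using hR.neg⟩
  · rintro ⟨R, hR⟩
    exact ⟨-R, by simpa using hR.neg⟩

theorem resolventOf_neg (z : ℂ) : resolventOf (-S) z = -resolventOf S (-z) := by
  by_cases hz : -z ∈ resolventSetOf S
  · have := (isResolventAt_resolventOf hz).neg
    rw [neg_neg] at this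
    exact this.resolventOf_eq
  · rw [resolventOf_of_notMem hz, resolventOf_of_notMem (mt mem_resolventSetOf_neg.1 hz), neg_zero]

theorem StripBound.neg {h : ℝ} (hst : StripBound S h) : StripBound (-S) h := by
  obtain ⟨h1, M, hM⟩ := hst
  refine ⟨fun z hz => mem_resolventSetOf_neg.2 (h1 _ (by simpa using hz)), M, fun z hz => ?_⟩
  rw [resolventOf_neg, norm_neg]
  exact hM _ (by simpa using hz)

theorem mem_boundedExtensionSpace_neg {H : Set ℂ} {x : X}
    (hx : x ∈ boundedExtensionSpace S H) : x ∈ boundedExtensionSpace (-S) (-H) := by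
  obtain ⟨φ, ha, he, C, hC⟩ := hx
  refine ⟨fun z => -φ (-z), ?_, fun z hz => ?_, C, fun z hz => ?_⟩
  · refine AnalyticOnNhd.neg (ha.comp (analyticOnNhd_id.neg) ?_)
    rintro z (hz | hz)
    · exact Or.inl hz
    · exact Or.inr (mem_resolventSetOf_neg.1 hz)
  · change -φ (-z) = _
    rw [resolventOf_neg, he _ (mem_resolventSetOf_neg.1 hz), neg_apply]
  · rw [norm_neg]
    exact hC _ hz

/-- With `APlus_neg` and `AMinus_neg`, this transfers the analytic results from the plus sign to the
minus sign. -/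
theorem GPlus_neg (S : X →ₗ.[ℂ] X) : GPlus (-S) = GMinus S := by
  have e1 : -{z : ℂ | z.re ≤ 0} = {z : ℂ | 0 ≤ z.re} := by ext; simp
  have e2 : -{z : ℂ | 0 ≤ z.re} = {z : ℂ | z.re ≤ 0} := by ext; simp
  ext x
  constructor
  · intro hx
    have := mem_boundedExtensionSpace_neg hx
    rwa [neg_neg, e1] at this
  · intro hx
    have := mem_boundedExtensionSpace_neg hx
    rwa [e2] at this

theorem lineIntegral_neg (S : X →ₗ.[ℂ] X) (c : ℝ) : lineIntegral (-S) c = -lineIntegral S (-c) := by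
  rw [lineIntegral, lineIntegral, ← integral_neg_eq_self, ← integral_neg]
  congr 1 with t : 1
  have e : (c : ℂ) + ((-t : ℝ) : ℂ) * Complex.I = -(((-c : ℝ) : ℂ) + t * Complex.I) := by
    push_cast; ring
  rw [e, resolventOf_neg, neg_neg, neg_sq, smul_neg]

theorem APlus_neg (S : X →ₗ.[ℂ] X) (h : ℝ) : APlus (-S) h = AMinus S h := by
  rw [APlus, AMinus, lineIntegral_neg, smul_neg, neg_div, neg_smul]

theorem AMinus_neg (S : X →ₗ.[ℂ] X) (h : ℝ) : AMinus (-S) h = APlus S h := by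
  rw [← APlus_neg, neg_neg]

end Resolvent

/-! ### The operators `A₊` and `A₋`, and the extension of the resolvent. -/

section LineIntegral

variable {X : Type*} [NormedAddCommGroup X] [NormedSpace ℂ X]
  {S : X →ₗ.[ℂ] X} {h : ℝ}

theorem integrable_inv_sq_line {c : ℝ} (hc0 : c ≠ 0) :
    Integrable fun t : ℝ => Complex.I * (1 / ((c : ℂ) + t * Complex.I) ^ 2) := by
  refine integrable_line (f := fun z => Complex.I * (1 / z ^ 2)) (C := (min (c ^ 2) 1)⁻¹)
    (continuous_const.mul (continuous_const.div ((continuous_line c).pow 2)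
      fun t => pow_ne_zero 2 (line_ne_zero hc0 t))) fun z hz => ?_
  rw [norm_mul, Complex.norm_I, one_mul, norm_div, norm_one, norm_pow, one_div]
  exact inv_normSq_le hc0 z (by rw [hz])

/-- Left of the perpendicular bisector of `0` and `r`, the nearer of the two points is `0`. -/
theorem norm_le_norm_sub_of_re {r : ℝ} {z : ℂ} (hr : 0 ≤ r) (hz : z.re ≤ r / 2) :
    ‖z‖ ≤ ‖(r : ℂ) - z‖ := by
  refine abs_le_of_sq_le_sq' ?_ (norm_nonneg _) |>.2
  rw [Complex.sq_norm, Complex.sq_norm, Complex.normSq_apply, Complex.normSq_apply]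
  simp
  nlinarith

/-- The part of `z⁻² (S - z)⁻¹` that is holomorphic in the strip; it differs from that function
by `z⁻² S⁻¹` and a multiple of `S⁻²` with a simple pole at the origin. -/
def regularPart (S : X →ₗ.[ℂ] X) (h : ℝ) (z : ℂ) : X →L[ℂ] X :=
  resolventOf S z ∘L (resolventOf S 0 ∘L resolventOf S 0) -
    (((2 * h : ℝ) : ℂ) - z)⁻¹ • (resolventOf S 0 ∘L resolventOf S 0)

/-- By the expansion, `z²` times the regular part is `R(z) - S⁻¹ - (2hz / (2h - z)) S⁻²`, which is
bounded in the strip. The auxiliary pole `2h` stays at distance at least `h`, so the regular part is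
itself bounded near `0`. -/
theorem exists_norm_regularPart_le (hst : StripBound S h) (hh : 0 < h) :
    ∃ C : ℝ, ∀ z : ℂ, -h ≤ z.re → z.re ≤ h → ‖regularPart S h z‖ ≤ C * (1 + z.im ^ 2)⁻¹ := by
  set B := resolventOf S 0 ∘L resolventOf S 0 with hB
  obtain ⟨M, hM⟩ := hst.2
  have h0 := hst.zero_mem hh
  have hM0 : 0 ≤ M := (norm_nonneg _).trans (hM 0 (by simpa using hh.le))
  refine ⟨(M * ‖B‖ + h⁻¹ * ‖B‖) + (2 * M + 2 * h * ‖B‖), fun z hz1 hz2 => ?_⟩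
  have hz : |z.re| ≤ h := abs_le.2 ⟨hz1, hz2⟩
  set g := regularPart S h z with hg
  rw [regularPart, ← hB] at hg
  have hlow : h ≤ ‖((2 * h : ℝ) : ℂ) - z‖ := by
    refine le_trans ?_ (Complex.re_le_norm _)
    rw [Complex.sub_re, Complex.ofReal_re]
    linarith
  have hne : ((2 * h : ℝ) : ℂ) - z ≠ 0 := norm_pos_iff.1 (hh.trans_le hlow)
  have b1 : ‖g‖ ≤ M * ‖B‖ + h⁻¹ * ‖B‖ := by
    rw [hg]
    refine (norm_sub_le _ _).trans (add_le_add ?_ ?_)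
    · exact (ContinuousLinearMap.opNorm_comp_le _ _).trans
        (mul_le_mul_of_nonneg_right (hM z hz) (norm_nonneg _))
    · rw [norm_smul, norm_inv]
      exact mul_le_mul_of_nonneg_right (inv_anti₀ hh hlow) (norm_nonneg _)
  have e : z ^ 2 • g = resolventOf S z - resolventOf S 0 -
      (((2 * h : ℝ) : ℂ) * (z * (((2 * h : ℝ) : ℂ) - z)⁻¹)) • B := by
    have e1 := resolventOf_eq_expansion h0 (hst.1 z hz)
    rw [← hB] at e1
    have e2 : z ^ 2 • (resolventOf S z ∘L B) = resolventOf S z - resolventOf S 0 - z • B := by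
      conv_rhs => rw [e1]
      abel
    have e3 : ((2 * h : ℝ) : ℂ) * (z * (((2 * h : ℝ) : ℂ) - z)⁻¹) =
        z + z ^ 2 * (((2 * h : ℝ) : ℂ) - z)⁻¹ := by
      field_simp
      ring
    rw [hg, smul_sub, e2, smul_smul, e3, add_smul]
    abel
  have b2 : ‖z‖ ^ 2 * ‖g‖ ≤ 2 * M + 2 * h * ‖B‖ := by
    rw [← norm_pow, ← norm_smul, e]
    refine (norm_sub_le _ _).trans (add_le_add ((norm_sub_le _ _).trans ?_) ?_)
    · linarith [hM z hz, hM 0 (by simpa using hh.le)]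
    · rw [norm_smul, norm_mul, Complex.norm_real, Real.norm_of_nonneg (by positivity), norm_mul,
        norm_inv]
      refine mul_le_mul_of_nonneg_right (mul_le_of_le_one_right (by positivity) ?_) (norm_nonneg _)
      rw [← div_eq_mul_inv]
      exact div_le_one_of_le₀ (norm_le_norm_sub_of_re (by positivity) (by linarith)) (norm_nonneg _)
  have b3 : z.im ^ 2 ≤ ‖z‖ ^ 2 := by
    rw [Complex.sq_norm, Complex.normSq_apply]
    nlinarith [sq_nonneg z.re]
  rw [← div_eq_mul_inv, le_div_iff₀ (by positivity)]
  nlinarith [mul_le_mul_of_nonneg_right b3 (norm_nonneg g)]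

variable [CompleteSpace X]

theorem integrable_lineIntegral (hst : StripBound S h) {c : ℝ} (hc : |c| ≤ h) (hc0 : c ≠ 0) :
    Integrable fun t : ℝ => (Complex.I * (1 / ((c : ℂ) + t * Complex.I) ^ 2)) •
      resolventOf S ((c : ℂ) + t * Complex.I) := by
  obtain ⟨M, hM⟩ := hst.2
  have hmem : ∀ z : ℂ, z.re = c → z ∈ resolventSetOf S := fun z hz => hst.1 z (hz ▸ hc)
  have hcont : Continuous fun t : ℝ => resolventOf S ((c : ℂ) + t * Complex.I) :=
    continuous_comp_line (s := resolventSetOf S)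
      (fun z hz => (differentiableAt_resolventOf hz).continuousAt.continuousWithinAt) hmem
  refine ((integrable_inv_sq_line hc0).norm.mul_const M).mono'
    ((integrable_inv_sq_line hc0).aestronglyMeasurable.smul hcont.aestronglyMeasurable)
    (ae_of_all _ fun t => ?_)
  rw [norm_smul]
  exact mul_le_mul_of_nonneg_left (hM _ (by rwa [line_re])) (norm_nonneg _)

theorem lineIntegral_apply (hst : StripBound S h) {c : ℝ} (hc : |c| ≤ h) (hc0 : c ≠ 0) (x : X) :
    lineIntegral S c x = ∫ t : ℝ, (Complex.I * (1 / ((c : ℂ) + t * Complex.I) ^ 2)) •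
      resolventOf S ((c : ℂ) + t * Complex.I) x :=
  ContinuousLinearMap.integral_apply (integrable_lineIntegral hst hc hc0) x

theorem integrable_lineIntegral_apply (hst : StripBound S h) {c : ℝ} (hc : |c| ≤ h) (hc0 : c ≠ 0)
    (x : X) : Integrable fun t : ℝ => (Complex.I * (1 / ((c : ℂ) + t * Complex.I) ^ 2)) •
      resolventOf S ((c : ℂ) + t * Complex.I) x :=
  (integrable_lineIntegral hst hc hc0).apply_continuousLinearMap x

/-- Operators commuting with the resolvents commute with the line integrals. -/
theorem lineIntegral_comm (hst : StripBound S h) {c : ℝ} (hc : |c| ≤ h) (hc0 : c ≠ 0)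
    {Q : X →L[ℂ] X}
    (hQ : ∀ z ∈ resolventSetOf S, Q ∘L resolventOf S z = resolventOf S z ∘L Q) (x : X) :
    Q (lineIntegral S c x) = lineIntegral S c (Q x) := by
  rw [lineIntegral_apply hst hc hc0, lineIntegral_apply hst hc hc0,
    ← ContinuousLinearMap.integral_comp_comm Q (integrable_lineIntegral_apply hst hc hc0 x)]
  congr 1 with t
  rw [map_smul]
  congr 1
  exact DFunLike.congr_fun (hQ _ (hst.1 _ (by rwa [line_re]))) x

theorem APlus_comm (hst : StripBound S h) (hh : 0 < h) {Q : X →L[ℂ] X}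
    (hQ : ∀ z ∈ resolventSetOf S, Q ∘L resolventOf S z = resolventOf S z ∘L Q) (x : X) :
    Q (APlus S h x) = APlus S h (Q x) := by
  simp only [APlus, smul_apply, map_smul]
  rw [lineIntegral_comm hst (abs_of_pos hh).le hh.ne' hQ]

/-- The line integral to the left annihilates `G₊`. -/
theorem AMinus_apply_of_mem_GPlus (hst : StripBound S h) (hh : 0 < h) {x : X}
    (hx : x ∈ GPlus S) : AMinus S h x = 0 := by
  obtain ⟨φ, ha, he, C, hC⟩ := hx
  have hn : -h < 0 := neg_lt_zero.2 hh
  have habs : |-h| ≤ h := by rw [abs_neg, abs_of_pos hh]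
  have hsub : ∀ z : ℂ, z.re ≤ -h → z.re ≤ 0 := fun z hz => hz.trans hn.le
  have key := integral_line_eq_zero_of_left (a := -h) (C := C) hn
    (f := fun z => (Complex.I * (1 / z ^ 2)) • φ z) ?_ ?_
  · rw [AMinus, smul_apply, lineIntegral_apply hst habs hn.ne]
    rw [← smul_zero ((-1 : ℂ) / (2 * (Real.pi : ℂ) * Complex.I)), ← key]
    congr 2 with t
    rw [he _ (hst.1 _ (by rwa [line_re]))]
  · refine DifferentiableOn.smul (DifferentiableOn.const_mul (DifferentiableOn.div
      (differentiableOn_const _) (by fun_prop) fun z hz => pow_ne_zero 2 ?_) _) fun z hz =>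
        (ha z (Or.inl (hsub z hz))).differentiableAt.differentiableWithinAt
    rintro rfl
    exact absurd hz (by simpa using hh)
  · intro z hz
    rw [norm_smul, norm_mul, Complex.norm_I, one_mul, norm_div, norm_one, norm_pow, one_div,
      mul_comm]
    exact mul_le_mul_of_nonneg_right (hC z (hsub z hz)) (by positivity)

/-- A point of `H ∪ ρ(S)` with `Re z ≥ h` lies in the open set `ρ(S)`, where the resolvent is
already analytic. Gluing it to `ψ` is harmless because the two agree on the overlap. -/
theorem mem_GPlus_of_extension (hh : 0 < h) {x : X} {ψ : ℂ → X}
    (hd : ∀ w : ℂ, w.re < h → DifferentiableAt ℂ ψ w)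
    (he : ∀ w ∈ resolventSetOf S, w.re < h → ψ w = resolventOf S w x)
    {K : ℝ} (hK : ∀ w : ℂ, w.re ≤ 0 → ‖ψ w‖ ≤ K) : x ∈ GPlus S := by
  classical
  have hH : IsOpen {w : ℂ | w.re < h} := isOpen_lt Complex.continuous_re continuous_const
  have hρ : ∀ z ∈ resolventSetOf S,
      (if z.re < h then ψ z else resolventOf S z x) = resolventOf S z x := fun z hz => by
    split_ifs with hzh
    · exact he z hz hzh
    · rfl
  refine ⟨fun w => if w.re < h then ψ w else resolventOf S w x, fun z hz => ?_, hρ, K,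
    fun w hw => ?_⟩
  · by_cases hzh : z.re < h
    · have ha : AnalyticAt ℂ ψ z := DifferentiableOn.analyticAt
        (fun w hw => (hd w hw).differentiableWithinAt) (hH.mem_nhds hzh)
      refine ha.congr ?_
      filter_upwards [hH.mem_nhds hzh] with w hw
      exact (if_pos hw).symm
    · have hz' : z ∈ resolventSetOf S :=
        hz.resolve_left fun hz0 => hzh (lt_of_le_of_lt hz0 hh)
      have hn := (isOpen_resolventSetOf S).mem_nhds hz'
      refine ((differentiableOn_resolventOf_apply S x).analyticAt hn).congr ?_
      filter_upwards [hn] with w hw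
      exact (hρ w hw).symm
  · have hw' : w.re ≤ 0 := hw
    simpa only [if_pos (hw'.trans_lt hh)] using hK w hw'

/-- The Cauchy-type integral which extends `w ↦ (S - w)⁻¹ A₊ x` to the half-plane `Re w < h`. -/
def cauchyExtension (S : X →ₗ.[ℂ] X) (h : ℝ) (x : X) (w : ℂ) : X :=
  (1 / (2 * (Real.pi : ℂ) * Complex.I)) • ∫ t : ℝ, ((h : ℂ) + t * Complex.I - w)⁻¹ •
    ((Complex.I * (1 / ((h : ℂ) + t * Complex.I) ^ 2)) •
      resolventOf S ((h : ℂ) + t * Complex.I) x)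

theorem differentiableAt_cauchyExtension (hst : StripBound S h) (hh : 0 < h) (x : X) {w : ℂ}
    (hw : w.re < h) : DifferentiableAt ℂ (cauchyExtension S h x) w :=
  (differentiableAt_cauchyIntegral
    (integrable_lineIntegral_apply hst (abs_of_pos hh).le hh.ne' x) hw).const_smul _

theorem exists_norm_cauchyExtension_le (hst : StripBound S h) (hh : 0 < h) (x : X) :
    ∃ K : ℝ, ∀ w : ℂ, w.re ≤ 0 → ‖cauchyExtension S h x w‖ ≤ K := by
  have hF := integrable_lineIntegral_apply hst (abs_of_pos hh).le hh.ne' x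
  refine ⟨‖1 / (2 * (Real.pi : ℂ) * Complex.I)‖ * ∫ t : ℝ, h⁻¹ *
    ‖(Complex.I * (1 / ((h : ℂ) + t * Complex.I) ^ 2)) •
      resolventOf S ((h : ℂ) + t * Complex.I) x‖, fun w hw => ?_⟩
  rw [cauchyExtension, norm_smul]
  refine mul_le_mul_of_nonneg_left (norm_integral_le_of_norm_le (hF.norm.const_mul _)
    (ae_of_all _ fun t => ?_)) (norm_nonneg _)
  rw [norm_smul, norm_inv]
  refine mul_le_mul_of_nonneg_right (inv_anti₀ hh ?_) (norm_nonneg _)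
  refine le_trans ?_ (Complex.re_le_norm _)
  rw [Complex.sub_re, line_re]
  linarith

/-- Both poles, `0` and `w`, lie to the left of the line. -/
theorem integral_inv_sub_mul_inv_sq (hh : 0 < h) {w : ℂ} (hw : w.re < h) :
    ∫ t : ℝ, ((h : ℂ) + t * Complex.I - w)⁻¹ *
      (Complex.I * (1 / ((h : ℂ) + t * Complex.I) ^ 2)) = 0 := by
  have hlow : ∀ z : ℂ, h ≤ z.re → h - w.re ≤ ‖z - w‖ := fun z hz => by
    refine le_trans ?_ (Complex.re_le_norm _)
    rw [Complex.sub_re]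
    linarith
  refine integral_line_eq_zero_of_right (C := (h - w.re)⁻¹) hh
    (f := fun z => (z - w)⁻¹ * (Complex.I * (1 / z ^ 2))) ?_ fun z hz => ?_
  · refine DifferentiableOn.mul (DifferentiableOn.inv (by fun_prop) fun z hz => ?_)
      (DifferentiableOn.const_mul (DifferentiableOn.div
      (differentiableOn_const _) (by fun_prop) fun z hz => pow_ne_zero 2 ?_) _)
    · exact norm_pos_iff.1 ((sub_pos.2 hw).trans_le (hlow z hz))
    · rintro rfl
      exact absurd hz (by simpa using hh)
  · rw [norm_mul, norm_mul, Complex.norm_I, one_mul, norm_div, norm_one, norm_pow, one_div,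
      norm_inv]
    exact mul_le_mul_of_nonneg_right (inv_anti₀ (sub_pos.2 hw) (hlow z hz)) (by positivity)

/-- Under the integral, `R(w) R(z) = (z - w)⁻¹ (R(z) - R(w))`; the `R(w)` term integrates to zero by
`integral_inv_sub_mul_inv_sq`. -/
theorem cauchyExtension_eq (hst : StripBound S h) (hh : 0 < h) (x : X) {w : ℂ}
    (hw : w.re < h) (hwρ : w ∈ resolventSetOf S) :
    cauchyExtension S h x w = resolventOf S w (APlus S h x) := by
  have habs := (abs_of_pos hh).le
  have hF := integrable_lineIntegral_apply hst habs hh.ne' x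
  rw [APlus, smul_apply, map_smul, lineIntegral_apply hst habs hh.ne',
    ← ContinuousLinearMap.integral_comp_comm _ hF, cauchyExtension]
  congr 1
  have hpt : ∀ t : ℝ, resolventOf S w ((Complex.I * (1 / ((h : ℂ) + t * Complex.I) ^ 2)) •
      resolventOf S ((h : ℂ) + t * Complex.I) x) =
      ((h : ℂ) + t * Complex.I - w)⁻¹ • ((Complex.I * (1 / ((h : ℂ) + t * Complex.I) ^ 2)) •
        resolventOf S ((h : ℂ) + t * Complex.I) x) -
      (((h : ℂ) + t * Complex.I - w)⁻¹ * (Complex.I * (1 / ((h : ℂ) + t * Complex.I) ^ 2))) •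
        resolventOf S w x := fun t => by
    set z : ℂ := (h : ℂ) + t * Complex.I with hz
    have hzρ : z ∈ resolventSetOf S := hst.1 z (by rwa [hz, line_re])
    have hne : z - w ≠ 0 := fun h0 => by
      have := congrArg Complex.re h0
      rw [Complex.sub_re, hz, line_re, Complex.zero_re] at this
      linarith
    have hid := DFunLike.congr_fun (resolventOf_sub hzρ hwρ) x
    rw [resolventOf_comm hzρ hwρ] at hid
    simp only [sub_apply, smul_apply, ContinuousLinearMap.comp_apply] at hid
    rw [map_smul, mul_smul (z - w)⁻¹, ← smul_sub, ← smul_sub, hid, smul_comm (z - w)⁻¹,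
      inv_smul_smul₀ hne]
  simp_rw [hpt]
  have hq := (integrable_inv_line_sub_smul (integrable_inv_sq_line hh.ne') hw).smul_const
    (resolventOf S w x)
  simp only [smul_eq_mul] at hq
  rw [integral_sub (integrable_inv_line_sub_smul hF hw) hq,
    integral_smul_const, integral_inv_sub_mul_inv_sq hh hw, zero_smul, sub_zero]

/-- The range of `A₊` lies in `G₊`. -/
theorem APlus_apply_mem_GPlus (hst : StripBound S h) (hh : 0 < h) (x : X) :
    APlus S h x ∈ GPlus S := by
  obtain ⟨K, hK⟩ := exists_norm_cauchyExtension_le hst hh x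
  exact mem_GPlus_of_extension hh (fun w hw => differentiableAt_cauchyExtension hst hh x hw)
    (fun w hwρ hw => cauchyExtension_eq hst hh x hw hwρ) hK

/-- If `A₊ x = S⁻² x`, then `x` lies in `G₊`. -/
theorem mem_GPlus_of_APlus_apply (hst : StripBound S h) (hh : 0 < h) {x : X}
    (hx : APlus S h x = resolventOf S 0 (resolventOf S 0 x)) : x ∈ GPlus S := by
  obtain ⟨K, hK⟩ := exists_norm_cauchyExtension_le hst hh x
  obtain ⟨M, hM⟩ := hst.2
  have h0 := hst.zero_mem hh
  -- The expansion of `R(w) x`, with `R(w) S⁻² x = R(w) A₊ x` replaced by its Cauchy extension.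
  set ψ : ℂ → X := fun w => resolventOf S 0 x + w • resolventOf S 0 (resolventOf S 0 x) +
    w ^ 2 • cauchyExtension S h x w with hψ
  have hd : ∀ w : ℂ, w.re < h → DifferentiableAt ℂ ψ w := fun w hw =>
    ((differentiableAt_const _).add (differentiableAt_id.smul_const _)).add
      ((differentiableAt_id.pow 2).smul (differentiableAt_cauchyExtension hst hh x hw))
  have he : ∀ w ∈ resolventSetOf S, w.re < h → ψ w = resolventOf S w x := fun w hwρ hw => by
    simp only [hψ]
    rw [cauchyExtension_eq hst hh x hw hwρ, hx]
    exact (DFunLike.congr_fun (resolventOf_eq_expansion h0 hwρ) x).symm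
  have hK0 : 0 ≤ K := (norm_nonneg _).trans (hK 0 (by simp))
  -- On the imaginary axis `ψ` is the resolvent, bounded by `M ‖x‖`; Phragmén–Lindelöf carries this
  -- bound to the half-plane.
  refine mem_GPlus_of_extension hh hd he (K := M * ‖x‖) fun w hw =>
    norm_le_of_quadratic_growth_left
    (K := ‖resolventOf S 0 x‖ + ‖resolventOf S 0 (resolventOf S 0 x)‖ + K)
    (fun z hz => (hd z (lt_of_le_of_lt hz hh)).differentiableWithinAt) (fun z hz => ?_)
    (fun z hz => ?_) hw
  · have h1 : 1 ≤ (1 + ‖z‖) ^ 2 := one_le_pow₀ (by linarith [norm_nonneg z])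
    have h2 : ‖z‖ ≤ (1 + ‖z‖) ^ 2 := by nlinarith [norm_nonneg z]
    have h3 : ‖z‖ ^ 2 ≤ (1 + ‖z‖) ^ 2 := by nlinarith [norm_nonneg z]
    refine (norm_add₃_le).trans ?_
    rw [norm_smul, norm_smul, norm_pow, add_mul, add_mul, mul_comm ‖z‖, mul_comm (‖z‖ ^ 2)]
    refine add_le_add (add_le_add (le_mul_of_one_le_right (norm_nonneg _) h1)
      (mul_le_mul_of_nonneg_left h2 (norm_nonneg _))) ?_
    exact mul_le_mul (hK z hz) h3 (by positivity) hK0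
  · have hz' : |z.re| ≤ h := by rw [hz, abs_zero]; exact hh.le
    rw [he z (hst.1 z hz') (hz ▸ hh)]
    exact (resolventOf S z).le_of_opNorm_le (hM z hz') x

/-! ### The sum of the two line integrals -/

/-- On `Re z = h` the number `2h - z` is the conjugate of `z`, so the integrand is `2h / (h² + t²)`.
This is where the residue appears. -/
theorem integral_inv_add_inv_line (hh : 0 < h) :
    ∫ t : ℝ, (((h : ℂ) + t * Complex.I)⁻¹ + (2 * h - ((h : ℂ) + t * Complex.I))⁻¹) =
      2 * Real.pi := by
  have hpt : ∀ t : ℝ, ((h : ℂ) + t * Complex.I)⁻¹ + (2 * h - ((h : ℂ) + t * Complex.I))⁻¹ =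
      ((2 / h * (1 + (t / h) ^ 2)⁻¹ : ℝ) : ℂ) := fun t => by
    have e : (2 * h - ((h : ℂ) + t * Complex.I)) = (h : ℂ) + ((-t : ℝ) : ℂ) * Complex.I := by
      push_cast; ring
    have n1 := line_ne_zero hh.ne' t
    have n2 := line_ne_zero hh.ne' (-t)
    have n3 : (h : ℂ) ≠ 0 := by exact_mod_cast hh.ne'
    have n4 : (1 + ((t : ℂ) / h) ^ 2) ≠ 0 := by
      have : (1 + (t / h) ^ 2 : ℝ) ≠ 0 := by positivity
      exact_mod_cast this
    have e2 : ((h : ℂ) + t * Complex.I) * ((h : ℂ) + ((-t : ℝ) : ℂ) * Complex.I) =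
        h ^ 2 * (1 + ((t : ℂ) / h) ^ 2) := by
      push_cast
      field_simp
      ring_nf
      rw [Complex.I_sq]
      ring
    rw [e, inv_add_inv n1 n2, e2]
    push_cast
    field_simp
    ring
  simp_rw [hpt]
  rw [integral_complex_ofReal, integral_const_mul,
    Measure.integral_comp_div (fun t : ℝ => (1 + t ^ 2)⁻¹), integral_univ_inv_one_add_sq,
    abs_of_pos hh, smul_eq_mul]
  push_cast
  have n3 : (h : ℂ) ≠ 0 := by exact_mod_cast hh.ne'
  field_simp

theorem integral_inv_sq_line {c : ℝ} (hc : c ≠ 0) :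
    ∫ t : ℝ, Complex.I * (1 / ((c : ℂ) + t * Complex.I) ^ 2) = 0 := by
  have hb : ∀ z : ℂ, ‖Complex.I * (1 / z ^ 2)‖ ≤ 1 * (‖z‖ ^ 2)⁻¹ := fun z => by
    rw [norm_mul, Complex.norm_I, norm_div, norm_one, norm_pow, one_div]
  have hd : ∀ s : Set ℂ, (0 : ℂ) ∉ s →
      DifferentiableOn ℂ (fun z : ℂ => Complex.I * (1 / z ^ 2)) s := fun s hs =>
    DifferentiableOn.const_mul (DifferentiableOn.div (differentiableOn_const _) (by fun_prop)
      fun z hz => pow_ne_zero 2 (by rintro rfl; exact hs hz)) _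
  rcases lt_or_gt_of_ne hc with hc | hc
  · exact integral_line_eq_zero_of_left (f := fun z => Complex.I * (1 / z ^ 2)) hc
      (hd _ (by simpa using hc)) fun z _ => hb z
  · exact integral_line_eq_zero_of_right (f := fun z => Complex.I * (1 / z ^ 2)) hc
      (hd _ (by simpa using hc)) fun z _ => hb z

/-- The summand `(r - z)⁻¹` cancels the non-integrable tail of `z⁻¹`, leaving quadratic decay. -/
theorem inv_add_inv_sub {r z : ℂ} (hz : z ≠ 0) (hrz : r - z ≠ 0) :
    z⁻¹ + (r - z)⁻¹ = r * (z⁻¹ * (r - z)⁻¹) := by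
  field_simp
  ring

theorem norm_inv_add_inv_sub_le {r : ℝ} {z : ℂ} (hr : 0 ≤ r) (hz0 : z ≠ 0) (hz : z.re ≤ r / 2) :
    ‖z⁻¹ + ((r : ℂ) - z)⁻¹‖ ≤ r * (‖z‖ ^ 2)⁻¹ := by
  have h1 := norm_le_norm_sub_of_re hr hz
  have h2 : 0 < ‖z‖ := norm_pos_iff.2 hz0
  rw [inv_add_inv_sub hz0 (norm_pos_iff.1 (h2.trans_le h1)), norm_mul, norm_mul, norm_inv, norm_inv,
    Complex.norm_real, Real.norm_of_nonneg hr, pow_two, mul_inv]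
  gcongr

theorem continuous_inv_add_inv_line {c r : ℝ} (hc : c ≠ 0) (hcr : c ≠ r) :
    Continuous fun t : ℝ => ((c : ℂ) + t * Complex.I)⁻¹ +
      ((r : ℂ) - ((c : ℂ) + t * Complex.I))⁻¹ := by
  refine ((continuous_line c).inv₀ (line_ne_zero hc)).add
    ((continuous_const.sub (continuous_line c)).inv₀ fun t h0 => hcr ?_)
  have := congrArg Complex.re h0
  simp at this
  linarith

theorem integrable_inv_add_inv_line {c r : ℝ} (hr : 0 < r) (hc : c ≠ 0) (hcr : c ≤ r / 2) :
    Integrable fun t : ℝ => ((c : ℂ) + t * Complex.I)⁻¹ +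
      ((r : ℂ) - ((c : ℂ) + t * Complex.I))⁻¹ := by
  refine integrable_line (f := fun z => z⁻¹ + ((r : ℂ) - z)⁻¹) (C := r * (min (c ^ 2) 1)⁻¹)
    (continuous_inv_add_inv_line hc (by linarith)) fun z hz => ?_
  have hz0 : z ≠ 0 := by rintro rfl; exact hc (by simpa using hz.symm)
  refine (norm_inv_add_inv_sub_le hr.le hz0 (hz ▸ hcr)).trans ?_
  rw [mul_assoc]
  exact mul_le_mul_of_nonneg_left (inv_normSq_le hc z (by rw [hz])) hr.le

/-- Both poles, `0` and `r`, lie to the right of the line. -/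
theorem integral_inv_add_inv_line_left {c r : ℝ} (hc : c < 0) (hr : 0 < r) :
    ∫ t : ℝ, (((c : ℂ) + t * Complex.I)⁻¹ + ((r : ℂ) - ((c : ℂ) + t * Complex.I))⁻¹) = 0 := by
  have hz0 : ∀ z : ℂ, z.re ≤ c → z ≠ 0 := by
    rintro z hz rfl
    exact absurd hz (by simpa using hc)
  refine integral_line_eq_zero_of_left (f := fun z => z⁻¹ + ((r : ℂ) - z)⁻¹) (C := r) hc ?_
    fun z hz => norm_inv_add_inv_sub_le hr.le (hz0 z hz) (by linarith)
  refine DifferentiableOn.add (DifferentiableOn.inv differentiableOn_id fun z hz => hz0 z hz)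
    (DifferentiableOn.inv (by fun_prop) fun z hz h0 => ?_)
  have h1 := congrArg Complex.re h0
  have h2 : z.re ≤ c := hz
  simp at h1
  linarith

theorem differentiableAt_regularPart (hst : StripBound S h) (hh : 0 < h) {z : ℂ}
    (hz : |z.re| ≤ h) : DifferentiableAt ℂ (regularPart S h) z := by
  have hne : ((2 * h : ℝ) : ℂ) - z ≠ 0 := fun h1 => by
    have := congrArg Complex.re h1
    rw [Complex.sub_re, Complex.ofReal_re, Complex.zero_re] at this
    linarith [(abs_le.1 hz).2]
  exact ((differentiableAt_resolventOf (hst.1 z hz)).clm_comp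
    (differentiableAt_const _)).sub ((((differentiableAt_const _).sub
    differentiableAt_id).inv hne).smul_const _)

/-- The expansion divided by `z²`, with `(2h - z)⁻¹ S⁻²` moved between terms so that each piece is
absolutely integrable. The `z⁻² S⁻¹` piece integrates to zero. -/
theorem lineIntegral_eq (hst : StripBound S h) (hh : 0 < h) {c : ℝ} (hc : |c| ≤ h)
    (hc0 : c ≠ 0) :
    lineIntegral S c = Complex.I • (∫ t : ℝ, regularPart S h ((c : ℂ) + t * Complex.I)) +
      (Complex.I * ∫ t : ℝ, (((c : ℂ) + t * Complex.I)⁻¹ +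
        (((2 * h : ℝ) : ℂ) - ((c : ℂ) + t * Complex.I))⁻¹)) •
        (resolventOf S 0 ∘L resolventOf S 0) := by
  set B := resolventOf S 0 ∘L resolventOf S 0 with hB
  have h0 := hst.zero_mem hh
  obtain ⟨C, hC⟩ := exists_norm_regularPart_le hst hh
  have hch := abs_le.1 hc
  have i1 : Integrable fun t : ℝ => Complex.I • regularPart S h ((c : ℂ) + t * Complex.I) := by
    have hcont : Continuous fun t : ℝ => regularPart S h ((c : ℂ) + t * Complex.I) :=
      continuous_comp_line (s := {z | z.re = c}) (fun z hz => ?_) fun z hz => hz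
    · exact (integrable_line hcont fun z hz => hC z (hz ▸ hch.1) (hz ▸ hch.2)).smul Complex.I
    have hz' : z.re = c := hz
    exact (differentiableAt_regularPart hst hh
      (hz'.symm ▸ hc)).continuousAt.continuousWithinAt
  have i2 := (integrable_inv_sq_line hc0).smul_const (resolventOf S 0)
  have i3 : Integrable fun t : ℝ => (Complex.I * (((c : ℂ) + t * Complex.I)⁻¹ +
      (((2 * h : ℝ) : ℂ) - ((c : ℂ) + t * Complex.I))⁻¹)) • B :=
    ((integrable_inv_add_inv_line (r := 2 * h) (by positivity) hc0
      (by linarith)).const_mul _).smul_const B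
  have i13 : Integrable fun t : ℝ => Complex.I • regularPart S h ((c : ℂ) + t * Complex.I) +
      (Complex.I * (((c : ℂ) + t * Complex.I)⁻¹ +
      (((2 * h : ℝ) : ℂ) - ((c : ℂ) + t * Complex.I))⁻¹)) • B :=
    Integrable.add (ε' := X →L[ℂ] X) i1 i3
  have hpt : ∀ t : ℝ, (Complex.I * (1 / ((c : ℂ) + t * Complex.I) ^ 2)) •
      resolventOf S ((c : ℂ) + t * Complex.I) =
      (Complex.I • regularPart S h ((c : ℂ) + t * Complex.I) +
      (Complex.I * (((c : ℂ) + t * Complex.I)⁻¹ +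
        (((2 * h : ℝ) : ℂ) - ((c : ℂ) + t * Complex.I))⁻¹)) • B) +
      (Complex.I * (1 / ((c : ℂ) + t * Complex.I) ^ 2)) • resolventOf S 0 := fun t => by
    have hn := line_ne_zero hc0 t
    have e1 := resolventOf_eq_expansion h0 (hst.1 ((c : ℂ) + t * Complex.I) (by rwa [line_re]))
    rw [← hB] at e1
    rw [regularPart, ← hB]
    set z : ℂ := (c : ℂ) + t * Complex.I
    conv_lhs => rw [e1]
    have e2 : 1 / z ^ 2 * z = z⁻¹ := by field_simp
    have e3 : 1 / z ^ 2 * z ^ 2 = 1 := by field_simp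
    simp only [mul_smul, ← smul_add]
    congr 1
    rw [smul_add, smul_add, smul_smul, smul_smul, e2, e3, one_smul, add_smul]
    abel
  rw [lineIntegral]
  simp_rw [hpt]
  rw [integral_add i13 i2, integral_add i1 i3, integral_smul, integral_smul_const,
    integral_smul_const, integral_const_mul, integral_inv_sq_line hc0, zero_smul, add_zero]

/-- `A₊ + A₋ = S⁻²`. -/
theorem APlus_add_AMinus (hst : StripBound S h) (hh : 0 < h) :
    APlus S h + AMinus S h = resolventOf S 0 ∘L resolventOf S 0 := by
  obtain ⟨C, hC⟩ := exists_norm_regularPart_le hst hh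
  -- The regular part has the same integral over both lines and cancels; only the pole term on the
  -- right line survives.
  have hg := integral_line_eq (a := -h) (b := h) (by linarith) (fun z hz =>
    (differentiableAt_regularPart hst hh (abs_le.2 hz)).differentiableWithinAt) hC
  have hn : -h < 0 := neg_lt_zero.2 hh
  have hlast := integral_inv_add_inv_line hh
  rw [APlus, AMinus, lineIntegral_eq hst hh (abs_of_pos hh).le hh.ne',
    lineIntegral_eq hst hh (c := -h) (by rw [abs_neg, abs_of_pos hh]) hn.ne, hg,
    integral_inv_add_inv_line_left hn (by positivity)]
  push_cast at hlast ⊢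
  rw [hlast, neg_div, neg_smul, mul_zero, zero_smul, add_zero, smul_add,
    add_comm, neg_add_cancel_left, smul_smul]
  have : (1 / (2 * (Real.pi : ℂ) * Complex.I)) * (Complex.I * (2 * Real.pi)) = 1 := by
    have := Complex.I_ne_zero
    have : (Real.pi : ℂ) ≠ 0 := by exact_mod_cast Real.pi_ne_zero
    field_simp
  rw [this, one_smul]

end LineIntegral

/-! ### Consequences of the algebraic relations. -/

section Algebra

variable {X : Type*} [NormedAddCommGroup X] [NormedSpace ℂ X]

/-- The algebraic relations between `A₊`, `A₋` and `G₊` (or `A₋`, `A₊` and `G₋`) on which the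
comparison of `M` and `G` rests. -/
structure IsSplitPair (S : X →ₗ.[ℂ] X) (A B : X →L[ℂ] X) (G : Submodule ℂ X) : Prop where
  zero_mem : (0 : ℂ) ∈ resolventSetOf S
  comm_left : ∀ x, resolventOf S 0 (A x) = A (resolventOf S 0 x)
  comm_right : ∀ x, resolventOf S 0 (B x) = B (resolventOf S 0 x)
  add_eq : ∀ x, A x + B x = resolventOf S 0 (resolventOf S 0 x)
  mem_iff : ∀ x, x ∈ G ↔ B x = 0
  apply_mem : ∀ x, A x ∈ G

theorem isDenselyDefinedIn_domRestrict_iff {S : X →ₗ.[ℂ] X} {G : Submodule ℂ X} :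
    IsDenselyDefinedIn (S.domRestrict G) G ↔
      ∀ x ∈ G, x ∈ closure {y : X | y ∈ G ∧ y ∈ S.domain} := by
  have e : Subtype.val '' {x : G | (x : X) ∈ (S.domRestrict G).domain} =
      {y : X | y ∈ G ∧ y ∈ S.domain} := by
    ext y
    constructor
    · rintro ⟨x, hx, rfl⟩
      exact hx
    · intro hy
      exact ⟨⟨y, hy.1⟩, hy, rfl⟩
  have hle : (S.domRestrict G).domain ≤ G := fun x hx => hx.1
  have key : Dense {x : G | (x : X) ∈ (S.domRestrict G).domain} ↔
      (G : Set X) ⊆ closure {y : X | y ∈ G ∧ y ∈ S.domain} := by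
    rw [← e]
    exact Subtype.dense_iff (s := (G : Set X))
  exact ⟨fun hd => key.1 hd.2, fun hd => ⟨hle, key.2 hd⟩⟩

/-- Since `D(S²)` is the range of `S⁻²`, the operator `S² A` can be handled through bounded
operators; the witness `y` is its value at `x`. -/
theorem mem_sqComp_domain_iff {S : X →ₗ.[ℂ] X} (h0 : (0 : ℂ) ∈ resolventSetOf S)
    {A : X →L[ℂ] X} {x : X} :
    x ∈ (sqComp S A).domain ↔ ∃ y, A x = resolventOf S 0 (resolventOf S 0 y) := by
  constructor
  · rintro ⟨x, ⟨u, hu, hux⟩, rfl⟩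
    refine ⟨S ⟨S u, hu⟩, ?_⟩
    rw [resolventOf_zero_apply h0, resolventOf_zero_apply h0]
    exact hux.symm
  · rintro ⟨y, hy⟩
    have hm := resolventOf_zero_mem h0 (resolventOf S 0 y)
    refine ⟨⟨x, trivial⟩, ⟨⟨A x, hy ▸ hm⟩, ?_, rfl⟩, rfl⟩
    change S ⟨A x, _⟩ ∈ S.domain
    rw [apply_resolventOf_zero h0 (y := resolventOf S 0 y) hy]
    exact resolventOf_zero_mem h0 y

theorem sqComp_apply {S : X →ₗ.[ℂ] X} (h0 : (0 : ℂ) ∈ resolventSetOf S)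
    {A : X →L[ℂ] X} (x : (sqComp S A).domain) {y : X}
    (hy : A x = resolventOf S 0 (resolventOf S 0 y)) : sqComp S A x = y := by
  refine apply_resolventOf_zero h0 ?_
  exact apply_resolventOf_zero h0 hy

namespace IsSplitPair

variable {S : X →ₗ.[ℂ] X} {A B : X →L[ℂ] X} {G : Submodule ℂ X}

theorem apply_of_mem (hp : IsSplitPair S A B G) {x : X} (hx : x ∈ G) :
    A x = resolventOf S 0 (resolventOf S 0 x) := by
  rw [← hp.add_eq, (hp.mem_iff x).1 hx, add_zero]

/-- `S⁻¹ B S x = B x = 0`, and `S⁻¹` is injective. -/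
theorem isInvariant (hp : IsSplitPair S A B G) : IsInvariant S G := fun x hx => by
  rw [hp.mem_iff] at hx ⊢
  refine resolventOf_zero_injective hp.zero_mem ?_
  rw [hp.comm_right, resolventOf_zero_apply hp.zero_mem, hx, map_zero]

theorem closure_range_le (hp : IsSplitPair S A B G) :
    (LinearMap.range (A : X →ₗ[ℂ] X)).topologicalClosure ≤ G := by
  refine Submodule.topologicalClosure_minimal _ ?_ ?_
  · rintro _ ⟨x, rfl⟩
    exact hp.apply_mem x
  · have : (G : Set X) = B ⁻¹' {0} := by
      ext x
      exact hp.mem_iff x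
    rw [this]
    exact isClosed_singleton.preimage B.continuous

/-- For `v ∈ G ∩ D(S)`, `S⁻¹ v = S⁻² (S v) = A (S v)`, so by density `S⁻¹ G` lies in the closure of
`range A`. Every `y ∈ G ∩ D(S)` is `S⁻¹ (S y)` with `S y ∈ G`; density is then used a second time.
-/
theorem closure_range_eq_of_isDenselyDefinedIn (hp : IsSplitPair S A B G)
    (hd : IsDenselyDefinedIn (S.domRestrict G) G) :
    (LinearMap.range (A : X →ₗ[ℂ] X)).topologicalClosure = G := by
  rw [isDenselyDefinedIn_domRestrict_iff] at hd
  refine le_antisymm hp.closure_range_le fun x hx => ?_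
  have h1 : ∀ y ∈ G, resolventOf S 0 y ∈ closure (Set.range A) := fun y hy => by
    refine map_mem_closure (resolventOf S 0).continuous (hd y hy) fun v hv => ?_
    refine ⟨S ⟨v, hv.2⟩, ?_⟩
    rw [hp.apply_of_mem (hp.isInvariant ⟨v, hv.2⟩ hv.1), resolventOf_zero_apply hp.zero_mem]
  have h2 : {y : X | y ∈ G ∧ y ∈ S.domain} ⊆ closure (Set.range A) := fun y hy => by
    have := h1 _ (hp.isInvariant ⟨y, hy.2⟩ hy.1)
    rwa [resolventOf_zero_apply hp.zero_mem] at this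
  exact closure_minimal h2 isClosed_closure (hd x hx)

/-- `A` maps the dense subspace `D(S)` into `G ∩ D(S)`, because it commutes with `S⁻¹`. -/
theorem isDenselyDefinedIn_of_closure_range_eq (hp : IsSplitPair S A B G)
    (hS : Dense (S.domain : Set X))
    (hM : (LinearMap.range (A : X →ₗ[ℂ] X)).topologicalClosure = G) :
    IsDenselyDefinedIn (S.domRestrict G) G := by
  rw [isDenselyDefinedIn_domRestrict_iff]
  have h1 : Set.range A ⊆ closure {y : X | y ∈ G ∧ y ∈ S.domain} := by
    rintro _ ⟨x, rfl⟩
    refine map_mem_closure A.continuous (hS x) fun v hv => ⟨hp.apply_mem v, ?_⟩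
    have := hp.comm_left (S ⟨v, hv⟩)
    rw [resolventOf_zero_apply hp.zero_mem] at this
    change A v ∈ S.domain
    rw [← this]
    exact resolventOf_zero_mem hp.zero_mem _
  intro x hx
  rw [← hM] at hx
  exact closure_minimal h1 isClosed_closure hx

theorem isDenselyDefinedIn_iff (hp : IsSplitPair S A B G) (hS : Dense (S.domain : Set X)) :
    IsDenselyDefinedIn (S.domRestrict G) G ↔
      (LinearMap.range (A : X →ₗ[ℂ] X)).topologicalClosure = G :=
  ⟨hp.closure_range_eq_of_isDenselyDefinedIn, hp.isDenselyDefinedIn_of_closure_range_eq hS⟩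

/-- For `x ∈ G`, `S⁻² x = A x` lies in the closed range; applying invariance twice recovers `x`. -/
theorem closure_range_eq_iff_isInvariant (hp : IsSplitPair S A B G) :
    (LinearMap.range (A : X →ₗ[ℂ] X)).topologicalClosure = G ↔
      IsInvariant S (LinearMap.range (A : X →ₗ[ℂ] X)).topologicalClosure := by
  refine ⟨fun h => by rw [h]; exact hp.isInvariant, fun h => ?_⟩
  refine le_antisymm hp.closure_range_le fun x hx => ?_
  have h1 : resolventOf S 0 (resolventOf S 0 x) ∈
      (LinearMap.range (A : X →ₗ[ℂ] X)).topologicalClosure :=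
    Submodule.le_topologicalClosure _ ⟨x, hp.apply_of_mem hx⟩
  have h2 := h ⟨_, resolventOf_zero_mem hp.zero_mem _⟩ h1
  rw [apply_resolventOf_zero hp.zero_mem rfl] at h2
  have h3 := h ⟨_, resolventOf_zero_mem hp.zero_mem _⟩ h2
  rwa [apply_resolventOf_zero hp.zero_mem rfl] at h3

theorem partIn_eq (hp : IsSplitPair S A B G) : partIn S G = S.domRestrict G := by
  have hdom : G ⊓ (G.comap S.toFun).map S.domain.subtype = G ⊓ S.domain := by
    ext x
    constructor
    · rintro ⟨hx, y, -, rfl⟩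
      exact ⟨hx, y.2⟩
    · rintro ⟨hx, hxS⟩
      exact ⟨hx, ⟨x, hxS⟩, hp.isInvariant ⟨x, hxS⟩ hx, rfl⟩
  refine LinearPMap.ext ?_ ?_
  · change G ⊓ (G.comap S.toFun).map S.domain.subtype ⊓ S.domain = G ⊓ S.domain
    rw [hdom, inf_assoc, inf_idem]
  · intro x hx hx'
    exact (LinearPMap.domRestrict_apply (y := ⟨x, hx'.2⟩) rfl).trans
      (LinearPMap.domRestrict_apply (y := ⟨x, hx'.2⟩) rfl).symm

/-- `S² A + S² B = I`, so that one summand is bounded if the other one is. -/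
theorem isBoundedOp_of_isBoundedOp (hp : IsSplitPair S A B G)
    (hb : IsBoundedOp (sqComp S A)) : IsBoundedOp (sqComp S B) := by
  obtain ⟨C, hC⟩ := hb
  have h0 := hp.zero_mem
  refine ⟨1 + C, fun x => ?_⟩
  obtain ⟨y, hy⟩ := (mem_sqComp_domain_iff h0).1 x.2
  -- If `B x = S⁻² y`, then `A x = S⁻² x - B x = S⁻² (x - y)`.
  have hA : A x = resolventOf S 0 (resolventOf S 0 (x - y)) := by
    rw [map_sub, map_sub, ← hp.add_eq, ← hy, add_sub_cancel_right]
  have hx : (x : X) ∈ (sqComp S A).domain := (mem_sqComp_domain_iff h0).2 ⟨_, hA⟩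
  have h1 := hC ⟨x, hx⟩
  rw [sqComp_apply h0 ⟨x, hx⟩ hA] at h1
  rw [sqComp_apply h0 x hy]
  calc ‖y‖ = ‖(x : X) - (x - y)‖ := by rw [sub_sub_cancel]
    _ ≤ ‖(x : X)‖ + ‖(x : X) - y‖ := norm_sub_le _ _
    _ ≤ ‖(x : X)‖ + C * ‖(x : X)‖ := by gcongr
    _ = (1 + C) * ‖(x : X)‖ := by ring

theorem dense_range_resolventOf_zero (hp : IsSplitPair S A B G) (hS : Dense (S.domain : Set X)) :
    DenseRange (resolventOf S 0) := by
  refine hS.mono fun x hx => ⟨S ⟨x, hx⟩, resolventOf_zero_apply hp.zero_mem ⟨x, hx⟩⟩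

/-- For `x ∈ G` choose `y` with `S⁻² y` close to `x`. Then `S² A (x - S⁻² y) = x - A y`, so
boundedness makes `A y` close to `x`. -/
theorem closure_range_eq_of_isBoundedOp (hp : IsSplitPair S A B G) (hS : Dense (S.domain : Set X))
    (hb : IsBoundedOp (sqComp S A)) :
    (LinearMap.range (A : X →ₗ[ℂ] X)).topologicalClosure = G := by
  obtain ⟨C, hC⟩ := hb
  have h0 := hp.zero_mem
  refine le_antisymm hp.closure_range_le fun x hx => ?_
  have hR := hp.dense_range_resolventOf_zero hS
  have hdense : DenseRange (resolventOf S 0 ∘ resolventOf S 0) :=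
    hR.comp hR (resolventOf S 0).continuous
  refine Metric.mem_closure_iff.2 fun ε hε => ?_
  -- `|C| + 1` is positive whatever the sign of `C`.
  obtain ⟨y, hy⟩ := hdense.exists_dist_lt x (ε := ε / (|C| + 1)) (by positivity)
  refine ⟨A y, ⟨y, rfl⟩, ?_⟩
  have hA : A (x - resolventOf S 0 (resolventOf S 0 y)) =
      resolventOf S 0 (resolventOf S 0 (x - A y)) := by
    rw [map_sub, hp.apply_of_mem hx, ← hp.comm_left, ← hp.comm_left, map_sub, map_sub]
  have hmem := (mem_sqComp_domain_iff h0).2 ⟨_, hA⟩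
  have h1 := hC ⟨_, hmem⟩
  rw [sqComp_apply h0 ⟨_, hmem⟩ hA] at h1
  rw [dist_eq_norm] at hy ⊢
  rw [lt_div_iff₀ (by positivity)] at hy
  refine lt_of_le_of_lt (h1.trans ?_) hy
  rw [mul_comm]
  exact mul_le_mul_of_nonneg_left ((le_abs_self C).trans (by linarith)) (norm_nonneg _)

/-- `Q n` commutes with `B`, hence preserves `G = ker B`; so `Q n x` approximates `x ∈ G` from
within `G ∩ D(S)`. -/
theorem closure_range_eq_of_approximation (hp : IsSplitPair S A B G) {Q : ℕ → X →L[ℂ] X}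
    (hQS : ∀ n x, Q n x ∈ S.domain) (hQB : ∀ n x, Q n (B x) = B (Q n x))
    (hQ : ∀ x, Tendsto (fun n => Q n x) atTop (𝓝 x)) :
    (LinearMap.range (A : X →ₗ[ℂ] X)).topologicalClosure = G := by
  refine hp.closure_range_eq_of_isDenselyDefinedIn
    (isDenselyDefinedIn_domRestrict_iff.2 fun x hx => ?_)
  refine mem_closure_of_tendsto (hQ x) (Eventually.of_forall fun n => ⟨?_, hQS n x⟩)
  rw [hp.mem_iff] at hx ⊢
  rw [← hQB, hx, map_zero]

end IsSplitPair

end Algebra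

/-! ### The algebraic relations verified for both signs. -/

section SplitPairs

variable {X : Type*} [NormedAddCommGroup X] [NormedSpace ℂ X] [CompleteSpace X]
  {S : X →ₗ.[ℂ] X} {h : ℝ}

theorem AMinus_comm (hst : StripBound S h) (hh : 0 < h) {Q : X →L[ℂ] X}
    (hQ : ∀ z ∈ resolventSetOf S, Q ∘L resolventOf S z = resolventOf S z ∘L Q) (x : X) :
    Q (AMinus S h x) = AMinus S h (Q x) := by
  rw [← APlus_neg]
  refine APlus_comm hst.neg hh (fun z hz => ?_) x
  have := hQ _ (mem_resolventSetOf_neg.1 hz)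
  rw [resolventOf_neg, ContinuousLinearMap.comp_neg, ContinuousLinearMap.neg_comp, this]

theorem mem_GPlus_iff (hst : StripBound S h) (hh : 0 < h) (x : X) :
    x ∈ GPlus S ↔ AMinus S h x = 0 := by
  refine ⟨AMinus_apply_of_mem_GPlus hst hh, fun hx => mem_GPlus_of_APlus_apply hst hh ?_⟩
  have := DFunLike.congr_fun (APlus_add_AMinus hst hh) x
  rw [add_apply, hx, add_zero] at this
  exact this

theorem isSplitPair_plus (hst : StripBound S h) (hh : 0 < h) :
    IsSplitPair S (APlus S h) (AMinus S h) (GPlus S) where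
  zero_mem := hst.zero_mem hh
  comm_left := APlus_comm hst hh fun _ hz => resolventOf_comm (hst.zero_mem hh) hz
  comm_right := AMinus_comm hst hh fun _ hz => resolventOf_comm (hst.zero_mem hh) hz
  add_eq := DFunLike.congr_fun (APlus_add_AMinus hst hh)
  mem_iff := mem_GPlus_iff hst hh
  apply_mem := APlus_apply_mem_GPlus hst hh

theorem isSplitPair_minus (hst : StripBound S h) (hh : 0 < h) :
    IsSplitPair S (AMinus S h) (APlus S h) (GMinus S) where
  zero_mem := hst.zero_mem hh
  comm_left := (isSplitPair_plus hst hh).comm_right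
  comm_right := (isSplitPair_plus hst hh).comm_left
  add_eq x := by rw [add_comm, (isSplitPair_plus hst hh).add_eq]
  mem_iff x := by rw [← GPlus_neg, mem_GPlus_iff hst.neg hh, AMinus_neg]
  apply_mem x := by
    rw [← GPlus_neg, ← APlus_neg]
    exact APlus_apply_mem_GPlus hst.neg hh x

end SplitPairs

end Splitting

end

theorem theorem6p3 {X : Type*} [NormedAddCommGroup X] [NormedSpace ℂ X] [CompleteSpace X]
    (S : X →ₗ.[ℂ] X) (hS : Dense (S.domain : Set X))
    (h : ℝ) (hh : 0 < h) (hstrip : Splitting.StripBound S h) :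
    -- (i)
    ((Splitting.IsDenselyDefinedIn (S.domRestrict (Splitting.GPlus S)) (Splitting.GPlus S) ↔
          Splitting.MPlus S h = Splitting.GPlus S) ∧
      (Splitting.MPlus S h = Splitting.GPlus S ↔
          Splitting.IsInvariant S (Splitting.MPlus S h)) ∧
      (Splitting.IsDenselyDefinedIn (S.domRestrict (Splitting.GMinus S)) (Splitting.GMinus S) ↔
          Splitting.MMinus S h = Splitting.GMinus S) ∧
      (Splitting.MMinus S h = Splitting.GMinus S ↔
          Splitting.IsInvariant S (Splitting.MMinus S h)) ∧
      (Splitting.MPlus S h = Splitting.GPlus S →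
          Splitting.partIn S (Splitting.MPlus S h) = S.domRestrict (Splitting.GPlus S)) ∧
      (Splitting.MMinus S h = Splitting.GMinus S →
          Splitting.partIn S (Splitting.MMinus S h) = S.domRestrict (Splitting.GMinus S))) ∧
    -- (ii)
    ((Splitting.IsBoundedOp (Splitting.PPlus S h) ↔
          Splitting.IsBoundedOp (Splitting.PMinus S h)) ∧
      (Splitting.IsBoundedOp (Splitting.PPlus S h) →
          Splitting.MPlus S h = Splitting.GPlus S ∧
            Splitting.MMinus S h = Splitting.GMinus S)) ∧
    -- (iii)
    (∀ Q : ℕ → X →L[ℂ] X,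
      (∀ n x, Q n x ∈ S.domain) →
      (∀ n, ∀ z ∈ Splitting.resolventSetOf S,
        Q n ∘L Splitting.resolventOf S z = Splitting.resolventOf S z ∘L Q n) →
      (∀ x, Tendsto (fun n => Q n x) atTop (𝓝 x)) →
      Splitting.MPlus S h = Splitting.GPlus S ∧
        Splitting.MMinus S h = Splitting.GMinus S) := by
  have hp := Splitting.isSplitPair_plus hstrip hh
  have hm := Splitting.isSplitPair_minus hstrip hh
  refine ⟨⟨hp.isDenselyDefinedIn_iff hS, hp.closure_range_eq_iff_isInvariant,
    hm.isDenselyDefinedIn_iff hS, hm.closure_range_eq_iff_isInvariant,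
    fun e => ?_, fun e => ?_⟩,
    ⟨⟨hp.isBoundedOp_of_isBoundedOp, hm.isBoundedOp_of_isBoundedOp⟩, fun hb =>
      ⟨hp.closure_range_eq_of_isBoundedOp hS hb,
        hm.closure_range_eq_of_isBoundedOp hS (hp.isBoundedOp_of_isBoundedOp hb)⟩⟩,
    fun Q hQS hQc hQ =>
      ⟨hp.closure_range_eq_of_approximation hQS
        (fun n x => Splitting.AMinus_comm hstrip hh (hQc n) x) hQ,
        hm.closure_range_eq_of_approximation hQS
        (fun n x => Splitting.APlus_comm hstrip hh (hQc n) x) hQ⟩⟩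
  · rw [e]
    exact hp.partIn_eq
  · rw [e]
    exact hm.partIn_eq
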